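/- **Proposition 5 (Ausubel auction).** *Auction.* $M$ identical units are sold to bidders $1,\dots,n$ in at most $T$ rounds, at prices $p^1<p^2<\dots<p^T$. Nature draws a state $\theta$, which determines for each bidder $i$ a valuation $v_i:\mathbb N\to\mathbb R$ with $v_i(0)=0$, nondecreasing, with nonincreasing increments, and otherwise arbitrary real values, and for each round an order of the bidders. Each bidder observes only her own valuation. Let $b_i^0$ be a given bound on $i$'s bids. In round $t$, as long as the auction is ongoing, every bidder $i$ simultaneously bids an integer $b_i^t$ with $0\le b_i^t\le b_i^{t-1}$; she has observed only her own past bids and that the auction is ongoing. Put $q_i^t=\max\{0,M-\sum_{j\ne i}b_j^t\}$ and $\hat q_i^t=M-\sum_{j\text{ before }i}b_j^{t-1}-\sum_{j\text{ after }i}b_j^t$ (in the order of round $t$). If $\sum_j b_j^t>M$, bidder $i$ holds $q_i^t$ units, the increment $q_i^t-q_i^{t-1}$ (with $q_i^0=0$) being bought at price $p^t$, and the auction goes on (at $t=T$ it stops with these holdings). If $\sum_j b_j^t\le M$, the auction ends; $i$'s final quantity is $\hat q_i^t$, replaced by $b_i^t$ if $\hat q_i^t<b_i^t$ and by $b_i^{t-1}$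 if $\hat q_i^t>b_i^{t-1}$ (sequential rationing), the additional units being bought at price $p^t$; from then on all bidders only have a dummy action. *Outcomes ("excess with bounds").* In each round $t$ that is played, bidder $i$ receives three outcomes $y_i^{t,1}=b_i^t$, $y_i^{t,2}=\min\{b_i^t,q_i^t\}$, $y_i^{t,3}=\hat q_i^t$; after the end of the auction she receives dummy outcomes $\delta$. Preferences $\succsim_i$ over pairs of a state and an arbitrary sequence of outcomes are represented by $v_i(Q)-\sum_{t<\tau}p^t(y^{t,2}-y^{t-1,2})-p^\tau(Q-y^{\tau-1,2})$, where $\tau$ is the last round before the first dummy, $Q=\max\{y^{\tau,2},\min\{y^{\tau-1,1},y^{\tau,3}\}\}$, $y^{0,1}=b_i^0$, $y^{0,2}=0$ (and by $0$ if $\tau=0$). For a single outcome $(t,r)$, $(\theta',y')\succsim_i^{t,r}(\theta,y)$ means that $\succsim_i$ ranks them so for every choice of all the other outcomes, the same on both sides. *Local stage dominance.* Let $h$ be an information set of round $t$ at which $i$ is active (has at least two available actions). $S_{-i}(h)$ is the set of pairs $s_{-i}$ of a state $\vartheta(s_{-i})$ and a strategy profile of the opponents that allow $h$ to be reached, and $S_i(h,a)$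 the set of $i$'s strategies that allow $h$ to be reached and choose $a$ there. Write $g(s_i,s_{-i})$ for the induced sequence of $i$'s outcomes, and $g^{\le t}(s_i,s_{-i})$ for it with all outcomes after round $t$ replaced by $\delta$. Split $S_{-i}(h)$ into four scenarios according to whether or not $i$ is never active again after choosing $a'$ at $h$, and whether or not she is never active again after choosing $a$. Action $a'$ *locally stage-dominates* $a$ at $h$ if for every scenario $S$ both conditions hold: 1. either (a) for every $s\in S_i(h,a)$ there is $s'\in S_i(h,a')$ which, against every element of $S$, from $i$'s first active information set after $h$ on takes the same action as $s$ in every round, and gives $i$ the same outcomes as $s$ in every round after $t$; or (b) for every $s\in S_i(h,a)$ there is $s'\in S_i(h,a')$ such that for every $s_{-i}\in S$, in state $\vartheta(s_{-i})$, $g(s',s_{-i})\succsim_i g^{\le t}(s',s_{-i})\succsim_i g(s,s_{-i})$ and $g^{\le t}(s,s_{-i})\succsim_i g(s,s_{-i})$; 2. for each $r=1,2,3$, either every pair of a state and an outcome $(t,r)$ that arises from $a'$ against some element of $S$ is $\succsim_i^{t,r}$-preferred to every such pair that arises from $a$ against some element of $S$; or against every element of $S$ the two actions give the same outcome $(t,r)$.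 An available action is *locally stage-dominated* at $h$ if another available action locally stage-dominates it. *Claim.* Let $h$ be any information set of a round $t<T$ at which bidder $i$ is active, and let $d_i^{t+1}$ be her true demand at next round's price, i.e. a maximizer of $v_i(q)-p^{t+1}q$ over $0\le q\le b_i^0$. Then every available bid $b<d_i^{t+1}$ other than the largest available bid $b_i^{t-1}$ is locally stage-dominated at $h$. More precisely, it is locally stage-dominated by every available bid $c$ with $b<c\le d_i^{t+1}$; in particular, if $d_i^{t+1}\le b_i^{t-1}$, every bid below $d_i^{t+1}$ is locally stage-dominated by $d_i^{t+1}$. -/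

import Mathlib

/-! ## Multistage games with outcomes that mature stage by stage -/

/-- A multistage game with an initial move of nature and flow outcomes.

A history after `t` stages is a state of nature together with the list of the `t` action profiles
played so far, the most recent one first. An information set of player `i` is identified with its
label in `Info i`: two histories lie in the same information set of `i` when they have the same
label. An outcome `e : Slot` (outcome number `r` of stage `t`) matures at stage `slotStage e`; it is
a function of the history after that stage. -/
structure MultistageGame (ι : Type*) where
  /-- states of nature -/
  State : Type*
  /-- the action sets -/
  Act : ι → Type
  /-- the number of stages -/
  T : ℕ
  /-- labels of the information sets -/
  Info : ι → Type
  /-- the information set of player `i` that contains a given history -/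
  info : ∀ i, State → List (∀ j, Act j) → Info i
  /-- the actions available at an information set -/
  avail : ∀ i, Info i → Set (Act i)
  /-- the stage of an information set -/
  infoStage : ∀ i, Info i → ℕ
  /-- the outcomes that mature during the game -/
  Slot : Type
  /-- the stage at which an outcome matures -/
  slotStage : Slot → ℕ
  /-- the possible personal realizations of an outcome -/
  Y : ι → Slot → Type
  /-- the dummy outcome -/
  dummy : ∀ i e, Y i e
  /-- the outcome functions -/
  g : ∀ i e, State → List (∀ j, Act j) → Y i e
  /-- the preferences `(θ', y') ≿ᵢ (θ, y)` -/
  pref : ∀ i, State × (∀ e, Y i e) → State × (∀ e, Y i e) → Prop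
  avail_nonempty : ∀ i h, (avail i h).Nonempty
  infoStage_info : ∀ i θ l, infoStage i (info i θ l) = l.length + 1
  perfect_recall : ∀ i θ θ' a a' l l', info i θ (a :: l) = info i θ' (a' :: l') →
    info i θ l = info i θ' l' ∧ a i = a' i
  slotStage_mem : ∀ e, 1 ≤ slotStage e ∧ slotStage e ≤ T
  pref_total : ∀ i x y, pref i x y ∨ pref i y x
  pref_trans : ∀ i x y z, pref i x y → pref i y z → pref i x z

namespace MultistageGame

variable {ι : Type*} (G : MultistageGame ι)

/-- Feasible histories: at every stage every player chose an available action. -/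
def Feasible (θ : G.State) : List (∀ j, G.Act j) → Prop
  | [] => True
  | a :: l => Feasible θ l ∧ ∀ j, a j ∈ G.avail j (G.info j θ l)

/-- The information sets `H_i`: labels of feasible non-terminal histories. -/
def infoSets (i : ι) : Set (G.Info i) :=
  {h | ∃ θ l, G.Feasible θ l ∧ l.length < G.T ∧ G.info i θ l = h}

/-- The active information sets `H_i^*`: at least two actions are available. -/
def activeInfoSets (i : ι) : Set (G.Info i) :=
  {h | h ∈ G.infoSets i ∧ (G.avail i h).Nontrivial}

/-- Strategies of player `i`. A strategy prescribes an available action at every information set;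
what it prescribes at information sets which its own earlier prescriptions exclude never matters
below, so that these are reduced strategies up to an immaterial completion. -/
def Strategy (i : ι) : Type _ :=
  {s : G.Info i → G.Act i // ∀ h ∈ G.infoSets i, s h ∈ G.avail i h}

/-- `S_{-i}`: a state of nature and a strategy for every opponent of `i`. -/
def OppStrategy (i : ι) : Type _ :=
  G.State × (∀ j : {j : ι // j ≠ i}, G.Strategy j.1)

variable {G}

/-- The history (without the state of nature) after `t` stages when `s` is played in state `θ`. -/
def play (θ : G.State) (s : ∀ j, G.Strategy j) : ℕ → List (∀ j, G.Act j)
  | 0 => []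
  | t + 1 => (fun j => (s j).1 (G.info j θ (play θ s t))) :: play θ s t

variable [DecidableEq ι]

/-- The strategy profile made of a strategy of `i` and strategies of the opponents. -/
def join {i : ι} (s : G.Strategy i) (σ : G.OppStrategy i) : ∀ j, G.Strategy j :=
  fun j => if hj : j = i then hj ▸ s else σ.2 ⟨j, hj⟩

/-- The actions in the history `ζ^t(s_i, s_{-i})`; its state of nature is `σ.1`. -/
def hist {i : ι} (s : G.Strategy i) (σ : G.OppStrategy i) (t : ℕ) : List (∀ j, G.Act j) :=
  play σ.1 (join s σ) t

/-- The information set of `i` reached after `t` stages (hence of stage `t + 1`). -/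
def infoAt {i : ι} (s : G.Strategy i) (σ : G.OppStrategy i) (t : ℕ) : G.Info i :=
  G.info i σ.1 (hist s σ t)

/-- The play of `(s_i, s_{-i})` passes through the information set `h`. -/
def Reaches {i : ι} (s : G.Strategy i) (σ : G.OppStrategy i) (h : G.Info i) : Prop :=
  ∃ t < G.T, infoAt s σ t = h

/-- `S_i(h, a)`: the strategies of `i` that allow to reach `h` and prescribe `a` there. -/
def ownStrategies {i : ι} (h : G.Info i) (a : G.Act i) : Set (G.Strategy i) :=
  {s | (∃ σ, Reaches s σ h) ∧ s.1 h = a}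

/-- `S_{-i}(h)`: the strategies of the opponents (and of nature) that allow to reach `h`. -/
def oppStrategies {i : ι} (h : G.Info i) : Set (G.OppStrategy i) :=
  {σ | ∃ s, Reaches s σ h}

/-- `S_{-i}^{a,h}`: the opponents' strategies after which `i` is never active again if she
chooses `a` at `h`. -/
def ending {i : ι} (h : G.Info i) (a : G.Act i) : Set (G.OppStrategy i) :=
  {σ | σ ∈ oppStrategies h ∧ ∀ s ∈ ownStrategies h a, ∀ m, G.infoStage i h ≤ m → m < G.T →
    infoAt s σ m ∉ G.activeInfoSets i}

/-- The ending partition of `S_{-i}(h)` for the comparison of `a'` with `a`. -/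
def endingPartition {i : ι} (h : G.Info i) (a' a : G.Act i) : Set (Set (G.OppStrategy i)) :=
  {ending h a ∩ ending h a', ending h a \ ending h a', ending h a' \ ending h a,
    oppStrategies h \ (ending h a' ∪ ending h a)}

/-- `s'` mimicks `s` given `h` and the scenario `S`: against every element of `S`, from the first
active information set after `h` on the path of `s'` onwards, `s'` prescribes on its path what `s`
prescribes on its own path at the same stage. -/
def Mimicks {i : ι} (h : G.Info i) (S : Set (G.OppStrategy i)) (s' s : G.Strategy i) : Prop :=
  ∀ σ ∈ S, ∀ m < G.T,
    (∃ k, G.infoStage i h ≤ k ∧ k ≤ m ∧ infoAt s' σ k ∈ G.activeInfoSets i) →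
      s'.1 (infoAt s' σ m) = s.1 (infoAt s σ m)

/-- The final sequence of outcomes `g_i(ζ(s_i, s_{-i}))`. Outcome `e` is evaluated at the history
after the stage at which it matures. -/
def outcomes {i : ι} (s : G.Strategy i) (σ : G.OppStrategy i) : ∀ e, G.Y i e :=
  fun e => G.g i e σ.1 (hist s σ (G.slotStage e))

/-- The outcomes up to stage `t`, followed by dummy outcomes only. -/
def outcomesUpTo {i : ι} (t : ℕ) (s : G.Strategy i) (σ : G.OppStrategy i) : ∀ e, G.Y i e :=
  fun e => if G.slotStage e ≤ t then outcomes s σ e else G.dummy i e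

/-- The scenario `S` is locally relevant for the ordered pair `(a', a)` at `h`: every plan after `a`
can be mimicked after `a'` so that all outcomes of later stages are the same. -/
def LocallyRelevant {i : ι} (h : G.Info i) (a' a : G.Act i) (S : Set (G.OppStrategy i)) : Prop :=
  ∀ s ∈ ownStrategies h a, ∃ s' ∈ ownStrategies h a', Mimicks h S s' s ∧
    ∀ σ ∈ S, ∀ e, G.infoStage i h < G.slotStage e → outcomes s' σ e = outcomes s σ e

/-- The incomplete preference `(θ', v') ≿_i^{e} (θ, v)` over realizations of the single outcome `e`:
it holds when the preference holds whatever the (equal) realizations of all other outcomes are. -/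
def slotPref (i : ι) (e : G.Slot) (θ' : G.State) (v' : G.Y i e) (θ : G.State) (v : G.Y i e) :
    Prop :=
  ∀ y' y : ∀ e, G.Y i e, y' e = v' → y e = v → (∀ e', e' ≠ e → y' e' = y e') →
    G.pref i (θ', y') (θ, y)

/-- The future is beneficial after the dominating action `a'` and detrimental after the dominated
action `a`: for every plan `s` after `a` there is a plan `s'` after `a'` such that, in the scenario,
the outcomes of `s'` are weakly preferred to those of `s'` cut at the current stage, while the
outcomes of `s` are weakly worse than those of `s` and also than those of the other plan, both cut at that
stage. -/
def FutureFavours {i : ι} (h : G.Info i) (a' a : G.Act i) (S : Set (G.OppStrategy i)) : Prop :=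
  ∀ s ∈ ownStrategies h a, ∃ s' ∈ ownStrategies h a', ∀ σ ∈ S,
    G.pref i (σ.1, outcomes s' σ) (σ.1, outcomesUpTo (G.infoStage i h) s' σ) ∧
    G.pref i (σ.1, outcomesUpTo (G.infoStage i h) s' σ) (σ.1, outcomes s σ) ∧
    G.pref i (σ.1, outcomesUpTo (G.infoStage i h) s σ) (σ.1, outcomes s σ)

/-- Action `a'` locally stage-dominates action `a` at `h`. The history through `h` that `s_{-i}` and
an action `a` of `i` at `h` induce does not depend on the choice of a strategy in `S_i(h, a)`, by
perfect recall; the second condition refers to it through all these strategies. -/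
def LocallyStageDominates {i : ι} (h : G.Info i) (a' a : G.Act i) : Prop :=
  ∀ S ∈ endingPartition h a' a,
    (LocallyRelevant h a' a S ∨ FutureFavours h a' a S) ∧
    ∀ e, G.slotStage e = G.infoStage i h →
      ((∀ σ' ∈ S, ∀ σ ∈ S, ∀ s' ∈ ownStrategies h a', ∀ s ∈ ownStrategies h a,
          slotPref i e σ'.1 (outcomes s' σ' e) σ.1 (outcomes s σ e)) ∨
        (∀ σ ∈ S, ∀ s' ∈ ownStrategies h a', ∀ s ∈ ownStrategies h a,
          outcomes s' σ e = outcomes s σ e))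

/-- Action `a` is locally stage-dominated at `h`: another available action locally
stage-dominates it. -/
def LocallyStageDominated {i : ι} (h : G.Info i) (a : G.Act i) : Prop :=
  ∃ a' ∈ G.avail i h, a' ≠ a ∧ LocallyStageDominates h a' a

end MultistageGame

/-! ## The discrete-clock Ausubel auction -/

/-- Valuations: `v q` is the value of `q` units; it is increasing in `q`, and every additional unit
adds less value than the previous one. -/
def BidderValuation : Type :=
  {v : ℕ → ℝ // v 0 = 0 ∧ Monotone v ∧ ∀ k, v (k + 2) - v (k + 1) ≤ v (k + 1) - v k}

/-- The data of a discrete-clock Ausubel auction with bidders `Fin n`. -/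
structure AusubelAuction (n : ℕ) where
  /-- the number of units for sale -/
  M : ℕ
  /-- the largest quantity that each bidder may bid for in the first round, `b_i^0` -/
  cap : Fin n → ℕ
  /-- the number of rounds -/
  T : ℕ
  /-- the price of each round; rounds are numbered from `1` -/
  p : ℕ → ℝ
  price_increasing : StrictMono p
  /-- states of nature -/
  State : Type*
  /-- the bidders' valuations -/
  val : State → Fin n → BidderValuation
  /-- the positions of the bidders in the order in which they are rationed, in each round -/
  order : State → ℕ → Equiv.Perm (Fin n)

/-- The three outcomes of every round: the maximum quantity for the next round, the minimum quantity
secured at the current round, and the excess quantity. -/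
inductive OutcomeKind
  | upper
  | lower
  | excess

namespace AusubelAuction

/-- Realizations of the three outcomes of a round; `none` is the dummy outcome. -/
def KindOutcome : OutcomeKind → Type
  | .upper => Option ℕ
  | .lower => Option ℕ
  | .excess => Option ℤ

variable {n : ℕ} (P : AusubelAuction n)

/-- A list of bid profiles, the most recent one first, after which the auction is over: in some
round the sum of all bids did not exceed the supply. -/
def isOver : List (Fin n → ℕ) → Bool
  | [] => false
  | b :: l => isOver l || decide (∑ j, b j ≤ P.M)

/-- The last bids in a list of bid profiles, with the convention `b_i^0 = cap i`. -/
def lastBids : List (Fin n → ℕ) → Fin n → ℕ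
  | [] => P.cap
  | b :: _ => b

/-- `max {0, M - ∑_{j ≠ i} b_j}`, by truncated subtraction. -/
def clinched (i : Fin n) (b : Fin n → ℕ) : ℕ :=
  P.M - ∑ j ∈ Finset.univ.erase i, b j

/-- `M - ∑_{j before i} b'_j - ∑_{j after i} b_j`, for the previous bids `b'`, the current bids `b`,
and the positions `π` of the bidders. -/
def rationed (π : Equiv.Perm (Fin n)) (b' b : Fin n → ℕ) (i : Fin n) : ℤ :=
  (P.M : ℤ) - ∑ j ∈ Finset.univ.filter (fun j => π j < π i), (b' j : ℤ)
    - ∑ j ∈ Finset.univ.filter (fun j => π i < π j), (b j : ℤ)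

/-- What bidder `i` observes: her own valuation, and for every past round (the most recent one first)
her own bid and whether the auction was over after that round. -/
def observe (i : Fin n) (θ : P.State) : List (Fin n → ℕ) → BidderValuation × List (ℕ × Bool)
  | [] => (P.val θ i, [])
  | b :: l => (P.val θ i, (b i, P.isOver (b :: l)) :: (observe i θ l).2)

/-- Available bids: at most the previous bid as long as the auction is ongoing; only the dummy
action `0` when the auction is over. -/
def bids (i : Fin n) : BidderValuation × List (ℕ × Bool) → Set ℕ
  | (_, []) => Set.Iic (P.cap i)
  | (_, (b, false) :: _) => Set.Iic b
  | (_, (_, true) :: _) => {0}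

/-- The "excess with bounds" outcomes of the last round of a history: `b_i^t`, `min {b_i^t, q_i^t}`
and the quantity `M - ∑_{j < i} b_j^{t-1} - ∑_{j > i} b_j^t`, and dummy outcomes if the auction
was over before that round. -/
def roundOutcome (i : Fin n) (θ : P.State) :
    (k : OutcomeKind) → List (Fin n → ℕ) → KindOutcome k
  | .upper, [] => (none : Option ℕ)
  | .lower, [] => (none : Option ℕ)
  | .excess, [] => (none : Option ℤ)
  | .upper, b :: l => if P.isOver l then (none : Option ℕ) else some (b i)
  | .lower, b :: l => if P.isOver l then (none : Option ℕ) else some (min (b i) (P.clinched i b))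
  | .excess, b :: l => if P.isOver l then (none : Option ℤ) else
      some (P.rationed (P.order θ (l.length + 1)) (P.lastBids l) b i)

/-- The dummy realization of an outcome. -/
def noOutcome : (k : OutcomeKind) → KindOutcome k
  | .upper => (none : Option ℕ)
  | .lower => (none : Option ℕ)
  | .excess => (none : Option ℤ)

/-- Sequences of outcomes; the outcomes of round `t` have first index `t - 1`. -/
abbrev OutcomeSeq : Type := ∀ e : Fin P.T × OutcomeKind, KindOutcome e.2

variable {P}

/-- `y^{t,1}`, with `y^{0,1} = b_i^0`. -/
def upperAt (i : Fin n) (y : P.OutcomeSeq) : ℕ → ℕ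
  | 0 => P.cap i
  | t + 1 => if ht : t < P.T then
      Option.getD (show Option ℕ from y (⟨t, ht⟩, .upper)) 0 else 0

/-- `y^{t,2}`, with `y^{0,2} = 0`. -/
def lowerAt (y : P.OutcomeSeq) : ℕ → ℕ
  | 0 => 0
  | t + 1 => if ht : t < P.T then
      Option.getD (show Option ℕ from y (⟨t, ht⟩, .lower)) 0 else 0

/-- `y^{t,3}`. -/
def excessAt (y : P.OutcomeSeq) : ℕ → ℤ
  | 0 => 0
  | t + 1 => if ht : t < P.T then
      Option.getD (show Option ℤ from y (⟨t, ht⟩, .excess)) 0 else 0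

open Classical in
/-- The last round of the auction according to a sequence of outcomes: the largest `τ` such that no
outcome of the rounds `1, …, τ` is a dummy. -/
noncomputable def lastRound (y : P.OutcomeSeq) : ℕ :=
  Nat.findGreatest (fun τ => ∀ (t : Fin P.T) (k : OutcomeKind), t.1 < τ → y (t, k) ≠ noOutcome k)
    P.T

/-- The final quantity: with `τ` the last round, the excess quantity `y^{τ,3}` if it lies between the
minimum `y^{τ,2}` and the maximum `y^{τ-1,1}`, otherwise the bound that it violates. -/
noncomputable def quantity (i : Fin n) (y : P.OutcomeSeq) : ℕ :=
  if lastRound y = 0 then 0 else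
    max (lowerAt y (lastRound y))
      (min (upperAt i y (lastRound y - 1)) (excessAt y (lastRound y)).toNat)

/-- The payment: in each round `t` before the last one the additional units `y^{t,2} - y^{t-1,2}` are
bought at price `p^t`, and the remaining units at the price of the last round. -/
noncomputable def payment (i : Fin n) (y : P.OutcomeSeq) : ℝ :=
  (∑ t ∈ Finset.Icc 1 (lastRound y - 1), P.p t * ((lowerAt y t : ℝ) - lowerAt y (t - 1)))
    + P.p (lastRound y) * ((quantity i y : ℝ) - lowerAt y (lastRound y - 1))

/-- The utility of bidder `i` from a sequence of outcomes. -/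
noncomputable def utility (i : Fin n) (θ : P.State) (y : P.OutcomeSeq) : ℝ :=
  (P.val θ i).1 (quantity i y) - payment i y

theorem observe_fst (i : Fin n) (θ : P.State) (l : List (Fin n → ℕ)) :
    (P.observe i θ l).1 = P.val θ i := by
  cases l <;> rfl

theorem observe_length (i : Fin n) (θ : P.State) (l : List (Fin n → ℕ)) :
    (P.observe i θ l).2.length = l.length := by
  induction l with
  | nil => rfl
  | cons b l ih => simp [observe, ih]

theorem bids_nonempty (i : Fin n) (h : BidderValuation × List (ℕ × Bool)) : (P.bids i h).Nonempty := by
  rcases h with ⟨v, _ | ⟨⟨b, _ | _⟩, l⟩⟩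
  · exact ⟨0, Nat.zero_le _⟩
  · exact ⟨0, Nat.zero_le _⟩
  · exact ⟨0, rfl⟩

variable (P)

/-- The Ausubel auction as a multistage game with flow outcomes. -/
noncomputable def game : MultistageGame (Fin n) where
  State := P.State
  Act := fun _ => ℕ
  T := P.T
  Info := fun _ => BidderValuation × List (ℕ × Bool)
  info := P.observe
  avail := P.bids
  infoStage := fun _ h => h.2.length + 1
  Slot := Fin P.T × OutcomeKind
  slotStage := fun e => e.1.1 + 1
  Y := fun _ e => KindOutcome e.2
  dummy := fun _ e => noOutcome e.2
  g := fun i e θ l => P.roundOutcome i θ e.2 l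
  pref := fun i x y => utility i y.1 y.2 ≤ utility i x.1 x.2
  avail_nonempty := bids_nonempty
  infoStage_info := fun i θ l => by rw [observe_length]
  perfect_recall := fun i θ θ' a a' l l' h => by
    simp only [observe, Prod.mk.injEq, List.cons.injEq] at h
    refine ⟨Prod.ext ?_ h.2.2, h.2.1.1⟩
    rw [observe_fst, observe_fst, h.1]
  slotStage_mem := fun e => ⟨Nat.le_add_left 1 _, e.1.2⟩
  pref_total := fun _ _ _ => le_total _ _
  pref_trans := fun _ _ _ _ h h' => h'.trans h

/-- The quantity `d` is a demand of bidder `i` with valuation `v` at price `x`: it maximizes the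
surplus `v q - x q` among the quantities that the bidder may bid for. -/
def IsDemand (i : Fin n) (v : BidderValuation) (x : ℝ) (d : ℕ) : Prop :=
  IsMaxOn (fun q : ℕ => v.1 q - x * q) (Set.Iic (P.cap i)) d ∧ d ≤ P.cap i

end AusubelAuction

/-! ### Paths of play and perfect recall. -/

namespace MultistageGame

variable {ι : Type*} {G : MultistageGame ι} [DecidableEq ι] {i : ι}

/-! Let $h$ belong to round $t$, let $b<c\le d$, and let $K$ be the sum of the opponents' bids in
round $t$. By perfect recall the history up to $h$ depends on $s_{-i}$ only (`hist_eq_of_reaches`),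
so $K$ is the same after both bids. After a bid $a$ bidder $i$ is never active again exactly if
$a=0$ or $a+K\le M$ (`mem_ending_iff`).

Two facts carry the comparison of utilities. Since increments are nonincreasing, the surplus is
nondecreasing in the quantity up to $d$, at $p^{t+1}$ and at every lower price (`surplus_mono`).
Summation by parts writes the utility as $v(Q)-p^\tau Q+\sum_{r<\tau}(p^{r+1}-p^r)y^{r,2}$
(`utility_eq`).

Outcomes of round $t$: $y^{t,1}$ matters only if $\tau=t+1$, as a cap on a quantity valued at
$p^{t+1}$ (`utility_mono_upper`); $y^{t,2}$ adds savings if $\tau>t$ and is a floor on $Q$ if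
$\tau=t$ (`utility_mono_lower`). Raising either up to $d$ is beneficial. The lower outcome rises
where $i$ is inactive after $b$ and is the same for both bids elsewhere; the excess outcome does not
involve $i$'s current bid.

Later rounds: if the auction ends even after $c$, only dummies follow. If $i$ stays active after
$b$, she does so after $c$; the opponents see no difference, and every later bid remains available,
so the plan is copied (`outcomeSeq_mimic`). If she stays active only after $c$, she bids $0$ next
(`futureFavours_of_subset`). Then either she finally gets between $\max\{0,M-K\}$ and $c\le d$
units, the additional ones at $p^{t+1}$, or the opponents alone exceed the supply and she has
utility $0$ with or without the future. Stopping after $c$ is in turn no worse than $b$, by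
monotonicity of the surplus at $p^t$, or because both utilities are $0$. -/

theorem join_self (s : G.Strategy i) (σ : G.OppStrategy i) : join s σ i = s := by
  simp [join]

theorem join_of_ne (s : G.Strategy i) (σ : G.OppStrategy i) {j : ι} (hj : j ≠ i) :
    join s σ j = σ.2 ⟨j, hj⟩ := by
  simp [join, hj]

theorem hist_succ (s : G.Strategy i) (σ : G.OppStrategy i) (t : ℕ) :
    hist s σ (t + 1) = (fun j => (join s σ j).1 (G.info j σ.1 (hist s σ t))) :: hist s σ t := rfl

theorem length_hist (s : G.Strategy i) (σ : G.OppStrategy i) (t : ℕ) :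
    (hist s σ t).length = t := by
  induction t with
  | zero => rfl
  | succ t ih => rw [hist_succ, List.length_cons, ih]

theorem feasible_hist (s : G.Strategy i) (σ : G.OppStrategy i) {t : ℕ} (ht : t ≤ G.T) :
    G.Feasible σ.1 (hist s σ t) := by
  induction t with
  | zero => trivial
  | succ t ih =>
    have hf := ih (Nat.le_of_succ_le ht)
    refine ⟨hf, fun j => (join s σ j).2 _ ⟨_, _, hf, ?_, rfl⟩⟩
    rw [length_hist]
    exact ht

theorem infoAt_mem_infoSets (s : G.Strategy i) (σ : G.OppStrategy i) {t : ℕ} (ht : t < G.T) :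
    infoAt s σ t ∈ G.infoSets i :=
  ⟨_, _, feasible_hist s σ ht.le, by rwa [length_hist], rfl⟩

theorem infoStage_infoAt (s : G.Strategy i) (σ : G.OppStrategy i) (t : ℕ) :
    G.infoStage i (infoAt s σ t) = t + 1 := by
  rw [infoAt, G.infoStage_info, length_hist]

/-- Strategies that agree along a path generate the same path. -/
theorem hist_congr {s s' : G.Strategy i} {σ : G.OppStrategy i} {m : ℕ}
    (h : ∀ k < m, s'.1 (infoAt s σ k) = s.1 (infoAt s σ k)) : hist s' σ m = hist s σ m := by
  induction m with
  | zero => rfl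
  | succ m ih =>
    have e := ih fun k hk => h k (hk.trans (Nat.lt_succ_self m))
    rw [hist_succ, hist_succ, e]
    congr 1
    funext j
    by_cases hj : j = i
    · subst hj
      rw [join_self, join_self]
      exact h m (Nat.lt_succ_self m)
    · rw [join_of_ne _ _ hj, join_of_ne _ _ hj]

/-- Perfect recall along paths. -/
theorem recall_infoAt {s s' : G.Strategy i} {σ σ' : G.OppStrategy i} {m : ℕ}
    (h : infoAt s σ m = infoAt s' σ' m) :
    ∀ k < m, infoAt s σ k = infoAt s' σ' k ∧ s.1 (infoAt s σ k) = s'.1 (infoAt s' σ' k) := by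
  induction m with
  | zero => intro k hk; exact absurd hk (Nat.not_lt_zero k)
  | succ m ih =>
    have := G.perfect_recall i _ _ _ _ _ _ h
    simp only [join_self] at this
    intro k hk
    rcases Nat.lt_succ_iff_lt_or_eq.mp hk with hk | rfl
    · exact ih this.1 k hk
    · exact this

/-- Reaching `h` is a product condition: a strategy of `i` that reaches `h` against some opponents
prescribes on the way the actions recorded in `h`, hence it also reaches `h` against any opponents
who allow it. -/
theorem hist_eq_of_reaches {s s' : G.Strategy i} {σ σ' : G.OppStrategy i} {h : G.Info i}
    (hs : Reaches s σ' h) (hσ : Reaches s' σ h) {m : ℕ} (hm : G.infoStage i h = m + 1) :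
    hist s σ m = hist s' σ m ∧ infoAt s σ m = h ∧ m < G.T := by
  obtain ⟨t, ht, e⟩ := hs
  obtain ⟨t', _, e'⟩ := hσ
  have h1 := infoStage_infoAt s σ' t
  have h2 := infoStage_infoAt s' σ t'
  rw [e, hm] at h1
  rw [e', hm] at h2
  obtain rfl : m = t := by omega
  obtain rfl : m = t' := by omega
  have key : hist s σ m = hist s' σ m := by
    refine hist_congr fun k hk => ?_
    have := recall_infoAt (e.trans e'.symm) k hk
    rw [← this.1, this.2, this.1]
  refine ⟨key, ?_, ht⟩
  rw [infoAt, key]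
  exact e'

end MultistageGame

/-! ### Surplus below the demand, and available bids. -/

namespace AusubelAuction

open MultistageGame

variable {n : ℕ} {P : AusubelAuction n} {i : Fin n}

/-- Optimality of `d` makes its last unit worth at least `x`. Earlier units are worth no less, hence
at least `x'`, and adding them one by one never lowers the surplus. -/
theorem surplus_mono {v : BidderValuation} {x x' : ℝ} {d q q' : ℕ} (hd : P.IsDemand i v x d)
    (hx : x' ≤ x) (hq : q ≤ q') (hq' : q' ≤ d) :
    v.1 q - x' * q ≤ v.1 q' - x' * q' := by
  obtain ⟨hmax, hcap⟩ := hd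
  have anti : Antitone fun k => v.1 (k + 1) - v.1 k := antitone_nat_of_succ_le v.2.2.2
  induction q', hq using Nat.le_induction with
  | base => exact le_rfl
  | succ m _ ih =>
    refine (ih (Nat.le_of_succ_le hq')).trans ?_
    obtain ⟨e, rfl⟩ : ∃ e, d = e + 1 := ⟨d - 1, by omega⟩
    have h1 : v.1 e - x * e ≤ v.1 (e + 1) - x * (e + 1 : ℕ) :=
      hmax (Set.mem_Iic.mpr (Nat.le_of_succ_le hcap))
    have h2 := anti (show m ≤ e by omega)
    simp only at h2
    push_cast at h1 ⊢
    linarith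

theorem sum_eq_add_others (i : Fin n) (b : Fin n → ℕ) :
    ∑ j, b j = b i + ∑ j ∈ Finset.univ.erase i, b j :=
  (Finset.add_sum_erase _ _ (Finset.mem_univ i)).symm

theorem bids_observe (i : Fin n) (θ : P.State) (l : List (Fin n → ℕ)) :
    P.bids i (P.observe i θ l) = if P.isOver l then {0} else Set.Iic (P.lastBids l i) := by
  cases l with
  | nil => rfl
  | cons b l =>
    cases h : P.isOver (b :: l) <;> simp [observe, bids, lastBids, h]

theorem zero_mem_bids (i : Fin n) (x : BidderValuation × List (ℕ × Bool)) : 0 ∈ P.bids i x := by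
  rcases x with ⟨v, _ | ⟨⟨b, _ | _⟩, l⟩⟩
  · exact Nat.zero_le _
  · exact Nat.zero_le _
  · rfl

theorem mem_bids_of_le {x : BidderValuation × List (ℕ × Bool)} {b c : ℕ} (hc : c ∈ P.bids i x)
    (hb : b ≤ c) : b ∈ P.bids i x := by
  rcases x with ⟨v, _ | ⟨⟨a, _ | _⟩, l⟩⟩
  · exact hb.trans hc
  · exact hb.trans hc
  · obtain rfl : c = 0 := hc
    exact Nat.le_zero.mp hb

/-! ### Bids and observations along a play. -/

/-- The bid that a strategy prescribes. -/
noncomputable def bidOf (s : P.game.Strategy i) (x : BidderValuation × List (ℕ × Bool)) : ℕ := s.1 x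

/-- The bid profiles of the first `m` rounds, the most recent one first. -/
noncomputable def path (s : P.game.Strategy i) (σ : P.game.OppStrategy i) (m : ℕ) :
    List (Fin n → ℕ) :=
  hist s σ m

/-- The bid profile of round `m`, which consists of the caps when `m = 0`. -/
noncomputable def profile (s : P.game.Strategy i) (σ : P.game.OppStrategy i) (m : ℕ) : Fin n → ℕ :=
  P.lastBids (path s σ m)

/-- The state of nature of an element of `S_{-i}`. -/
noncomputable def nature (σ : P.game.OppStrategy i) : P.State := σ.1

/-- What bidder `i` has observed after `m` rounds. -/
noncomputable def observed (s : P.game.Strategy i) (σ : P.game.OppStrategy i) (m : ℕ) :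
    BidderValuation × List (ℕ × Bool) :=
  P.observe i (nature σ) (path s σ m)

theorem path_succ (s : P.game.Strategy i) (σ : P.game.OppStrategy i) (m : ℕ) :
    path s σ (m + 1) = profile s σ (m + 1) :: path s σ m := rfl

theorem length_path (s : P.game.Strategy i) (σ : P.game.OppStrategy i) (m : ℕ) :
    (path s σ m).length = m :=
  length_hist s σ m

theorem length_observed (s : P.game.Strategy i) (σ : P.game.OppStrategy i) (m : ℕ) :
    (observed s σ m).2.length = m := by
  rw [observed, observe_length, length_path]

theorem observed_mem_infoSets (s : P.game.Strategy i) (σ : P.game.OppStrategy i) {m : ℕ}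
    (hm : m < P.T) : observed s σ m ∈ P.game.infoSets i :=
  infoAt_mem_infoSets s σ hm

theorem bidOf_mem_bids (s : P.game.Strategy i) (σ : P.game.OppStrategy i) {m : ℕ} (hm : m < P.T) :
    bidOf s (observed s σ m) ∈ P.bids i (observed s σ m) :=
  s.2 _ (observed_mem_infoSets s σ hm)

theorem profile_succ_self (s : P.game.Strategy i) (σ : P.game.OppStrategy i) (m : ℕ) :
    profile s σ (m + 1) i = bidOf s (observed s σ m) := by
  change (join s σ i).1 (observed s σ m) = _
  rw [join_self]
  rfl

theorem profile_succ_of_ne (s : P.game.Strategy i) (σ : P.game.OppStrategy i) (m : ℕ) {j : Fin n}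
    (hj : j ≠ i) :
    profile s σ (m + 1) j = (σ.2 ⟨j, hj⟩).1 (P.observe j (nature σ) (path s σ m)) := by
  change (join s σ j).1 _ = _
  rw [join_of_ne s σ hj]
  rfl

theorem profile_succ_le (s : P.game.Strategy i) (σ : P.game.OppStrategy i) {m : ℕ} (hm : m < P.T)
    (j : Fin n) : profile s σ (m + 1) j ≤ profile s σ m j := by
  have hf : P.game.Feasible σ.1 (hist s σ (m + 1)) := feasible_hist s σ (t := m + 1) hm
  have h : profile s σ (m + 1) j ∈ P.bids j (P.observe j (nature σ) (path s σ m)) := hf.2 j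
  rw [bids_observe] at h
  split_ifs at h
  · rw [Set.mem_singleton_iff.mp h]
    exact Nat.zero_le _
  · exact h

theorem profile_anti (s : P.game.Strategy i) (σ : P.game.OppStrategy i) {k m : ℕ} (hkm : k ≤ m)
    (hm : m ≤ P.T) (j : Fin n) : profile s σ m j ≤ profile s σ k j := by
  induction m, hkm using Nat.le_induction with
  | base => exact le_rfl
  | succ m _ ih => exact (profile_succ_le s σ hm j).trans (ih (Nat.le_of_succ_le hm))

theorem isOver_path_succ (s : P.game.Strategy i) (σ : P.game.OppStrategy i) (m : ℕ) :
    P.isOver (path s σ (m + 1)) = (P.isOver (path s σ m) || decide (∑ j, profile s σ (m + 1) j ≤ P.M)) :=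
  rfl

theorem isOver_path_mono (s : P.game.Strategy i) (σ : P.game.OppStrategy i) {k m : ℕ} (hkm : k ≤ m)
    (h : P.isOver (path s σ k)) : P.isOver (path s σ m) := by
  induction m, hkm using Nat.le_induction with
  | base => exact h
  | succ m _ ih => rw [isOver_path_succ, ih, Bool.true_or]

theorem observed_mem_active_iff (s : P.game.Strategy i) (σ : P.game.OppStrategy i) {m : ℕ}
    (hm : m < P.T) :
    observed s σ m ∈ P.game.activeInfoSets i ↔
      P.isOver (path s σ m) = false ∧ 0 < profile s σ m i := by
  have h1 : observed s σ m ∈ P.game.infoSets i :=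
    observed_mem_infoSets s σ hm
  have h2 : observed s σ m ∈ P.game.activeInfoSets i ↔
      (P.bids i (P.observe i (nature σ) (path s σ m))).Nontrivial :=
    ⟨fun h => h.2, fun h => ⟨h1, h⟩⟩
  rw [h2, bids_observe]
  cases h : P.isOver (path s σ m)
  · simp only [Bool.false_eq_true, if_false, true_and]
    constructor
    · rintro ⟨x, hx, y, hy, hxy⟩
      have hx : x ≤ profile s σ m i := hx
      have hy : y ≤ profile s σ m i := hy
      omega
    · exact fun h0 => ⟨0, Nat.zero_le _, _, Set.mem_Iic.mpr le_rfl, h0.ne⟩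
  · simp

/-! ### Deviations from a strategy at an information set. -/

open Classical in
/-- The strategy that plays `f` where this is possible, and the bid `0` elsewhere. -/
noncomputable def clamp (i : Fin n) (f : BidderValuation × List (ℕ × Bool) → ℕ) :
    P.game.Strategy i :=
  ⟨fun x => show ℕ from if f x ∈ P.bids i x then f x else 0, fun x _ => by
    change (if f x ∈ P.bids i x then f x else 0) ∈ P.bids i x
    split_ifs with h
    · exact h
    · exact zero_mem_bids i x⟩

theorem bidOf_clamp {f : BidderValuation × List (ℕ × Bool) → ℕ}
    {x : BidderValuation × List (ℕ × Bool)} (h : f x ∈ P.bids i x) :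
    bidOf (clamp (P := P) i f) x = f x :=
  if_pos h

open Classical in
/-- The strategy that follows `s` up to the stage of `h`, except that it chooses `c` at `h`, and
then follows `f`. -/
noncomputable def deviate (s : P.game.Strategy i) (h : BidderValuation × List (ℕ × Bool)) (c : ℕ)
    (f : BidderValuation × List (ℕ × Bool) → ℕ) : P.game.Strategy i :=
  clamp i fun x => if x = h then c else if x.2.length ≤ h.2.length then bidOf s x else f x

theorem bidOf_deviate_self (s : P.game.Strategy i) {h : BidderValuation × List (ℕ × Bool)} {c : ℕ}
    (hc : c ∈ P.bids i h) (f : BidderValuation × List (ℕ × Bool) → ℕ) :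
    bidOf (deviate s h c f) h = c := by
  unfold deviate
  rw [bidOf_clamp]
  · rw [if_pos rfl]
  · rwa [if_pos rfl]

theorem bidOf_deviate_before {s : P.game.Strategy i} {h x : BidderValuation × List (ℕ × Bool)}
    (c : ℕ) (f : BidderValuation × List (ℕ × Bool) → ℕ) (hx : x.2.length < h.2.length)
    (hs : bidOf s x ∈ P.bids i x) : bidOf (deviate s h c f) x = bidOf s x := by
  have hne : x ≠ h := by
    rintro rfl
    omega
  unfold deviate
  rw [bidOf_clamp]
  · rw [if_neg hne, if_pos hx.le]
  · rwa [if_neg hne, if_pos hx.le]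

theorem bidOf_deviate_after (s : P.game.Strategy i) {h x : BidderValuation × List (ℕ × Bool)}
    (c : ℕ) {f : BidderValuation × List (ℕ × Bool) → ℕ} (hx : h.2.length < x.2.length)
    (hf : f x ∈ P.bids i x) : bidOf (deviate s h c f) x = f x := by
  have hne : x ≠ h := by
    rintro rfl
    omega
  unfold deviate
  rw [bidOf_clamp]
  · rw [if_neg hne, if_neg (by omega)]
  · rwa [if_neg hne, if_neg (by omega)]

/-- Before the stage of `h` the deviation copies `s` on the path, so the opponents against whom `s`
reaches `h` serve for it as well. -/
theorem deviate_mem_ownStrategies {s : P.game.Strategy i} {h : BidderValuation × List (ℕ × Bool)}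
    {b c : ℕ} (hs : s ∈ ownStrategies (G := P.game) (i := i) h b) (hc : c ∈ P.bids i h)
    (f : BidderValuation × List (ℕ × Bool) → ℕ) :
    deviate s h c f ∈ ownStrategies (G := P.game) (i := i) h c := by
  obtain ⟨⟨σ, t, ht, e⟩, -⟩ := hs
  have e : observed s σ t = h := e
  have hlen : h.2.length = t := by rw [← e, length_observed]
  refine ⟨⟨σ, t, ht, ?_⟩, bidOf_deviate_self s hc f⟩
  have : hist (deviate s h c f) σ t = hist s σ t := by
    refine hist_congr fun k hk => ?_
    refine bidOf_deviate_before (x := observed s σ k) c f ?_ (bidOf_mem_bids s σ (hk.trans ht))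
    rwa [length_observed, hlen]
  rw [infoAt, this]
  exact e

/-! ### Histories through `h`, and bids after which the bidder is inactive. -/

/-- Histories through `h` against a given element of `S_{-i}(h)`. -/
theorem path_of_mem {h : BidderValuation × List (ℕ × Bool)} {a a' : ℕ}
    {s s' : P.game.Strategy i} {σ : P.game.OppStrategy i}
    (hs : s ∈ ownStrategies (G := P.game) (i := i) h a)
    (hs' : s' ∈ ownStrategies (G := P.game) (i := i) h a')
    (hσ : σ ∈ oppStrategies (G := P.game) (i := i) h) :
    path s σ h.2.length = path s' σ h.2.length := by
  obtain ⟨s₀, h₀⟩ := hσ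
  obtain ⟨⟨σ₁, h₁⟩, -⟩ := hs
  obtain ⟨⟨σ₂, h₂⟩, -⟩ := hs'
  exact (hist_eq_of_reaches h₁ h₀ (m := h.2.length) rfl).1.trans
    (hist_eq_of_reaches h₂ h₀ (m := h.2.length) rfl).1.symm

theorem observed_of_mem {h : BidderValuation × List (ℕ × Bool)} {a : ℕ}
    {s : P.game.Strategy i} {σ : P.game.OppStrategy i}
    (hs : s ∈ ownStrategies (G := P.game) (i := i) h a)
    (hσ : σ ∈ oppStrategies (G := P.game) (i := i) h) :
    observed s σ h.2.length = h := by
  obtain ⟨s₀, h₀⟩ := hσ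
  obtain ⟨⟨σ₁, h₁⟩, -⟩ := hs
  exact (hist_eq_of_reaches h₁ h₀ (m := h.2.length) rfl).2.1

theorem profile_self_of_mem {h : BidderValuation × List (ℕ × Bool)} {a : ℕ}
    {s : P.game.Strategy i} {σ : P.game.OppStrategy i}
    (hs : s ∈ ownStrategies (G := P.game) (i := i) h a)
    (hσ : σ ∈ oppStrategies (G := P.game) (i := i) h) :
    profile s σ (h.2.length + 1) i = a := by
  rw [profile_succ_self, observed_of_mem hs hσ]
  exact hs.2

theorem profile_ne_of_mem {h : BidderValuation × List (ℕ × Bool)} {a a' : ℕ}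
    {s s' : P.game.Strategy i} {σ : P.game.OppStrategy i}
    (hs : s ∈ ownStrategies (G := P.game) (i := i) h a)
    (hs' : s' ∈ ownStrategies (G := P.game) (i := i) h a')
    (hσ : σ ∈ oppStrategies (G := P.game) (i := i) h) {j : Fin n} (hj : j ≠ i) :
    profile s σ (h.2.length + 1) j = profile s' σ (h.2.length + 1) j := by
  rw [profile_succ_of_ne _ _ _ hj, profile_succ_of_ne _ _ _ hj, path_of_mem hs hs' hσ]

theorem others_of_mem {h : BidderValuation × List (ℕ × Bool)} {a a' : ℕ}
    {s s' : P.game.Strategy i} {σ : P.game.OppStrategy i}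
    (hs : s ∈ ownStrategies (G := P.game) (i := i) h a)
    (hs' : s' ∈ ownStrategies (G := P.game) (i := i) h a')
    (hσ : σ ∈ oppStrategies (G := P.game) (i := i) h) :
    ∑ j ∈ Finset.univ.erase i, profile s σ (h.2.length + 1) j =
      ∑ j ∈ Finset.univ.erase i, profile s' σ (h.2.length + 1) j :=
  Finset.sum_congr rfl fun _ hj => profile_ne_of_mem hs hs' hσ (Finset.ne_of_mem_erase hj)

theorem val_of_mem {h : BidderValuation × List (ℕ × Bool)} {σ : P.game.OppStrategy i}
    (hσ : σ ∈ oppStrategies (G := P.game) (i := i) h) : P.val (nature σ) i = h.1 := by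
  obtain ⟨s, t, _, e⟩ := hσ
  rw [← e]
  exact (observe_fst i (nature σ) _).symm

/-- Only `0` is available once the auction is over, so a positive available bid `c` certifies that
it is ongoing at `h`, whatever `i` actually bids there. -/
theorem not_isOver_of_mem {h : BidderValuation × List (ℕ × Bool)} {a c : ℕ}
    {s : P.game.Strategy i} {σ : P.game.OppStrategy i} (hc : c ∈ P.bids i h) (hpos : 0 < c)
    (hs : s ∈ ownStrategies (G := P.game) (i := i) h a)
    (hσ : σ ∈ oppStrategies (G := P.game) (i := i) h) :
    P.isOver (path s σ h.2.length) = false := by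
  rw [← observed_of_mem hs hσ, observed, bids_observe] at hc
  by_contra ho
  rw [Bool.not_eq_false] at ho
  rw [if_pos ho] at hc
  exact hpos.ne' hc

/-- After the bid `a` at `h`, bidder `i` is never active again if and only if the bid is `0` or the
auction ends. -/
theorem mem_ending_iff {h : BidderValuation × List (ℕ × Bool)} {a c : ℕ}
    {s : P.game.Strategy i} {σ : P.game.OppStrategy i} (hc : c ∈ P.bids i h) (hpos : 0 < c)
    (hT : h.2.length + 1 < P.T)
    (hs : s ∈ ownStrategies (G := P.game) (i := i) h a)
    (hσ : σ ∈ oppStrategies (G := P.game) (i := i) h) :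
    σ ∈ ending (G := P.game) (i := i) h a ↔
      a = 0 ∨ a + ∑ j ∈ Finset.univ.erase i, profile s σ (h.2.length + 1) j ≤ P.M := by
  constructor
  · rintro ⟨-, hend⟩
    -- Testing activity in the very next round suffices; `hT` ensures that this round exists.
    have h1 : ¬ observed s σ (h.2.length + 1) ∈ P.game.activeInfoSets i :=
      hend s hs (h.2.length + 1) le_rfl hT
    rw [observed_mem_active_iff s σ hT, isOver_path_succ, not_isOver_of_mem hc hpos hs hσ,
      sum_eq_add_others i, profile_self_of_mem hs hσ] at h1
    simp only [Bool.false_or, decide_eq_false_iff_not, not_and, not_lt, not_le] at h1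
    by_contra! hcon
    exact hcon.1 (Nat.le_zero.mp (h1 hcon.2))
  · intro hor
    refine ⟨hσ, fun s' hs' m hm hmT => ?_⟩
    have hm : h.2.length + 1 ≤ m := hm
    change ¬ observed s' σ m ∈ P.game.activeInfoSets i
    rw [observed_mem_active_iff s' σ hmT]
    rintro ⟨h1, h2⟩
    rcases hor with rfl | hle
    · have := profile_anti s' σ hm (le_of_lt hmT) i
      rw [profile_self_of_mem hs' hσ] at this
      omega
    · have : P.isOver (path s' σ (h.2.length + 1)) = true := by
        rw [isOver_path_succ, sum_eq_add_others i, profile_self_of_mem hs' hσ,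
          others_of_mem hs' hs hσ]
        simp [hle]
      rw [isOver_path_mono s' σ hm this] at h1
      exact absurd h1 (by simp)

/-! ### Last round and utility of an outcome sequence. -/

theorem lastRound_le (y : P.OutcomeSeq) : lastRound y ≤ P.T := by
  classical exact Nat.findGreatest_le _

theorem ne_noOutcome_of_lt_lastRound (y : P.OutcomeSeq) (t : Fin P.T) (k : OutcomeKind)
    (ht : t.1 < lastRound y) : y (t, k) ≠ noOutcome k := by
  classical
  have hspec : ∀ (t : Fin P.T) (k : OutcomeKind), t.1 < lastRound y → y (t, k) ≠ noOutcome k := by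
    unfold lastRound
    exact Nat.findGreatest_spec
      (P := fun τ => ∀ (t : Fin P.T) (k : OutcomeKind), t.1 < τ → y (t, k) ≠ noOutcome k)
      (Nat.zero_le P.T) (fun _ _ h => absurd h (Nat.not_lt_zero _))
  exact hspec t k ht

theorem le_lastRound {y : P.OutcomeSeq} {τ : ℕ} (hτ : τ ≤ P.T)
    (h : ∀ (t : Fin P.T) (k : OutcomeKind), t.1 < τ → y (t, k) ≠ noOutcome k) :
    τ ≤ lastRound y := by
  classical exact Nat.le_findGreatest hτ h

/-- The last round depends only on which outcomes are dummies, so changing the value of a non-dummy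
outcome keeps it. -/
theorem lastRound_congr {y y' : P.OutcomeSeq}
    (h : ∀ e, y' e = noOutcome e.2 ↔ y e = noOutcome e.2) : lastRound y' = lastRound y := by
  apply le_antisymm
  · exact le_lastRound (lastRound_le _) fun t k ht hy =>
      ne_noOutcome_of_lt_lastRound y' t k ht ((h (t, k)).mpr hy)
  · exact le_lastRound (lastRound_le _) fun t k ht hy =>
      ne_noOutcome_of_lt_lastRound y t k ht ((h (t, k)).mp hy)

/-- Summation by parts of a telescoping payment. -/
theorem sum_price_mul_sub (p : ℕ → ℝ) (L : ℕ → ℝ) (hL : L 0 = 0) (k : ℕ) :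
    ∑ t ∈ Finset.Icc 1 k, p t * (L t - L (t - 1)) =
      p (k + 1) * L k - ∑ t ∈ Finset.Icc 1 k, (p (t + 1) - p t) * L t := by
  induction k with
  | zero => simp [hL]
  | succ k ih =>
    rw [Finset.sum_Icc_succ_top (Nat.le_add_left 1 k), Finset.sum_Icc_succ_top (Nat.le_add_left 1 k),
      ih, Nat.add_sub_cancel]
    ring

/-- The utility is the surplus at the last price, plus what is saved on units bought earlier. -/
theorem utility_eq (i : Fin n) (θ : P.State) (y : P.OutcomeSeq) :
    utility i θ y = (P.val θ i).1 (quantity i y) - P.p (lastRound y) * quantity i y +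
      ∑ t ∈ Finset.Icc 1 (lastRound y - 1), (P.p (t + 1) - P.p t) * (lowerAt y t : ℝ) := by
  have h0 : lowerAt y 0 = 0 := rfl
  have habel := sum_price_mul_sub P.p (fun t => (lowerAt y t : ℝ)) (by simp [h0]) (lastRound y - 1)
  rw [utility, payment]
  rw [habel]
  -- If no round is played, `lastRound y - 1 + 1` is `1` and not `lastRound y`; this is harmless
  -- because the quantity and `lowerAt y 0` vanish.
  rcases Nat.eq_zero_or_pos (lastRound y) with hz | hpos
  · have hq : quantity i y = 0 := by rw [quantity, if_pos hz]
    simp [hz, hq, h0]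
  · rw [Nat.sub_add_cancel hpos]
    ring

theorem lowerAt_congr {y y' : P.OutcomeSeq} {r : ℕ}
    (h : ∀ t : Fin P.T, t.1 + 1 = r → y' (t, .lower) = y (t, .lower)) :
    lowerAt y' r = lowerAt y r := by
  cases r with
  | zero => rfl
  | succ r =>
    by_cases hr : r < P.T
    · exact (dif_pos hr).trans ((congrArg (fun z : Option ℕ => z.getD 0) (h ⟨r, hr⟩ rfl)).trans
        (show lowerAt y (r + 1) = _ from dif_pos hr).symm)
    · exact (dif_neg hr).trans (show lowerAt y (r + 1) = 0 from dif_neg hr).symm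

theorem upperAt_congr (i : Fin n) {y y' : P.OutcomeSeq} {r : ℕ}
    (h : ∀ t : Fin P.T, t.1 + 1 = r → y' (t, .upper) = y (t, .upper)) :
    upperAt i y' r = upperAt i y r := by
  cases r with
  | zero => rfl
  | succ r =>
    by_cases hr : r < P.T
    · exact (dif_pos hr).trans ((congrArg (fun z : Option ℕ => z.getD 0) (h ⟨r, hr⟩ rfl)).trans
        (show upperAt i y (r + 1) = _ from dif_pos hr).symm)
    · exact (dif_neg hr).trans (show upperAt i y (r + 1) = 0 from dif_neg hr).symm

theorem excessAt_congr {y y' : P.OutcomeSeq} {r : ℕ}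
    (h : ∀ t : Fin P.T, t.1 + 1 = r → y' (t, .excess) = y (t, .excess)) :
    excessAt y' r = excessAt y r := by
  cases r with
  | zero => rfl
  | succ r =>
    by_cases hr : r < P.T
    · exact (dif_pos hr).trans ((congrArg (fun z : Option ℤ => z.getD 0) (h ⟨r, hr⟩ rfl)).trans
        (show excessAt y (r + 1) = _ from dif_pos hr).symm)
    · exact (dif_neg hr).trans (show excessAt y (r + 1) = 0 from dif_neg hr).symm

theorem lowerAt_eq {y : P.OutcomeSeq} {t : Fin P.T} {q : ℕ}
    (h : y (t, .lower) = (some q : Option ℕ)) : lowerAt y (t.1 + 1) = q :=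
  (dif_pos t.2).trans (congrArg (fun z : Option ℕ => z.getD 0) h)

theorem upperAt_eq (i : Fin n) {y : P.OutcomeSeq} {t : Fin P.T} {q : ℕ}
    (h : y (t, .upper) = (some q : Option ℕ)) : upperAt i y (t.1 + 1) = q :=
  (dif_pos t.2).trans (congrArg (fun z : Option ℕ => z.getD 0) h)

theorem excessAt_eq {y : P.OutcomeSeq} {t : Fin P.T} {q : ℤ}
    (h : y (t, .excess) = (some q : Option ℤ)) : excessAt y (t.1 + 1) = q :=
  (dif_pos t.2).trans (congrArg (fun z : Option ℤ => z.getD 0) h)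

/-- A larger upper bound for the next round, up to the demand at the next price, is preferred. -/
theorem utility_mono_upper {θ θ' : P.State} {v : BidderValuation} (hθ : P.val θ i = v)
    (hθ' : P.val θ' i = v) {t : Fin P.T} {b c d : ℕ}
    (hd : P.IsDemand i v (P.p (t.1 + 2)) d) (hbc : b ≤ c) (hcd : c ≤ d)
    {y y' : P.OutcomeSeq} (hy' : y' (t, .upper) = (some c : Option ℕ))
    (hy : y (t, .upper) = (some b : Option ℕ))
    (h : ∀ e, e ≠ (t, OutcomeKind.upper) → y' e = y e) :
    utility i θ y ≤ utility i θ' y' := by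
  have hτ : lastRound y' = lastRound y := by
    refine lastRound_congr fun e => ?_
    by_cases he : e = (t, .upper)
    · subst he
      rw [hy, hy']
      exact ⟨fun h => (Option.some_ne_none _ h).elim, fun h => (Option.some_ne_none _ h).elim⟩
    · rw [h e he]
  have hL : ∀ r, lowerAt y' r = lowerAt y r := fun r =>
    lowerAt_congr fun u _ => h _ (by simp)
  have hE : ∀ r, excessAt y' r = excessAt y r := fun r =>
    excessAt_congr fun u _ => h _ (by simp)
  rw [utility_eq, utility_eq, hθ, hθ', hτ]
  simp only [hL]
  gcongr ?_ + _
  -- Index `t` stands for round `t + 1`, so its upper outcome caps the final quantity only if the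
  -- last round is `t + 2`, whose price is the one at which `d` is demanded.
  by_cases hr : lastRound y = t.1 + 2
  · have hq : quantity i y = max (lowerAt y (t.1 + 2)) (min b (excessAt y (t.1 + 2)).toNat) := by
      rw [quantity, hr, if_neg (by omega), show t.1 + 2 - 1 = t.1 + 1 from rfl, upperAt_eq i hy]
    have hq' : quantity i y' = max (lowerAt y (t.1 + 2)) (min c (excessAt y (t.1 + 2)).toNat) := by
      rw [quantity, hτ, hr, if_neg (by omega), show t.1 + 2 - 1 = t.1 + 1 from rfl,
        upperAt_eq i hy', hL, hE]
    rw [hr]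
    -- Either the cap `c` makes no difference, or the new quantity is at most `c ≤ d`.
    rcases (show quantity i y = quantity i y' ∨ quantity i y ≤ quantity i y' ∧ quantity i y' ≤ d by
      omega) with e | ⟨h1, h2⟩
    · rw [e]
    · exact surplus_mono hd le_rfl h1 h2
  · have hq : quantity i y' = quantity i y := by
      rw [quantity, quantity, hτ, hL, hE]
      split_ifs with h0
      · rfl
      · rw [upperAt_congr i fun u hu => h _ ?_]
        rintro ⟨⟩
        omega
    rw [hq]

/-- A larger quantity secured in the current round, up to the demand at the next price, is
preferred. -/
theorem utility_mono_lower {θ θ' : P.State} {v : BidderValuation} (hθ : P.val θ i = v)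
    (hθ' : P.val θ' i = v) {t : Fin P.T} {b c d : ℕ}
    (hd : P.IsDemand i v (P.p (t.1 + 2)) d) (hbc : b ≤ c) (hcd : c ≤ d)
    {y y' : P.OutcomeSeq} (hy' : y' (t, .lower) = (some c : Option ℕ))
    (hy : y (t, .lower) = (some b : Option ℕ))
    (h : ∀ e, e ≠ (t, OutcomeKind.lower) → y' e = y e) :
    utility i θ y ≤ utility i θ' y' := by
  have hτ : lastRound y' = lastRound y := by
    refine lastRound_congr fun e => ?_
    by_cases he : e = (t, .lower)
    · subst he
      rw [hy, hy']
      exact ⟨fun h => (Option.some_ne_none _ h).elim, fun h => (Option.some_ne_none _ h).elim⟩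
    · rw [h e he]
  have hLne : ∀ r, r ≠ t.1 + 1 → lowerAt y' r = lowerAt y r := fun r hr =>
    lowerAt_congr fun u hu => h _ (by rintro ⟨⟩; exact hr hu.symm)
  have hL : ∀ r, lowerAt y r ≤ lowerAt y' r := fun r => by
    by_cases hr : r = t.1 + 1
    · rw [hr, lowerAt_eq hy, lowerAt_eq hy']
      exact hbc
    · exact (hLne r hr).ge
  have hE : ∀ r, excessAt y' r = excessAt y r := fun r =>
    excessAt_congr fun u _ => h _ (by simp)
  have hU : ∀ r, upperAt i y' r = upperAt i y r := fun r =>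
    upperAt_congr i fun u _ => h _ (by simp)
  rw [utility_eq, utility_eq, hθ, hθ', hτ]
  apply add_le_add
  · by_cases hr : lastRound y = t.1 + 1
    · have hq : quantity i y = max b (min (upperAt i y t.1) (excessAt y (t.1 + 1)).toNat) := by
        rw [quantity, hr, if_neg (by omega), Nat.add_sub_cancel, lowerAt_eq hy]
      have hq' : quantity i y' = max c (min (upperAt i y t.1) (excessAt y (t.1 + 1)).toNat) := by
        rw [quantity, hτ, hr, if_neg (by omega), Nat.add_sub_cancel, lowerAt_eq hy', hU, hE]
      rw [hr]
      rcases (show quantity i y = quantity i y' ∨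
        quantity i y ≤ quantity i y' ∧ quantity i y' ≤ d by omega) with e | ⟨h1, h2⟩
      · rw [e]
      · exact surplus_mono hd (P.price_increasing.monotone (Nat.le_succ _)) h1 h2
    · have hq : quantity i y' = quantity i y := by
        rw [quantity, quantity, hτ, hU, hE, hLne _ hr]
      rw [hq]
  -- Prices rise, so securing more units early only increases the savings.
  · refine Finset.sum_le_sum fun r _ => ?_
    have := P.price_increasing.monotone (Nat.le_succ r)
    exact mul_le_mul_of_nonneg_left (Nat.cast_le.mpr (hL r)) (sub_nonneg.mpr this)

/-! ### Outcomes of a play, complete or cut after a round. -/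

/-- The outcomes of a play. -/
noncomputable def outcomeSeq (s : P.game.Strategy i) (σ : P.game.OppStrategy i) : P.OutcomeSeq :=
  outcomes s σ

/-- The outcomes of a play, cut after round `k`. -/
noncomputable def outcomeSeqUpTo (k : ℕ) (s : P.game.Strategy i) (σ : P.game.OppStrategy i) :
    P.OutcomeSeq :=
  outcomesUpTo k s σ

theorem outcomeSeq_apply (s : P.game.Strategy i) (σ : P.game.OppStrategy i)
    (e : Fin P.T × OutcomeKind) :
    outcomeSeq s σ e = P.roundOutcome i (nature σ) e.2 (path s σ (e.1.1 + 1)) := rfl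

theorem outcomeSeqUpTo_of_lt {k : ℕ} (s : P.game.Strategy i) (σ : P.game.OppStrategy i)
    {e : Fin P.T × OutcomeKind} (he : e.1.1 < k) : outcomeSeqUpTo k s σ e = outcomeSeq s σ e :=
  if_pos he

theorem outcomeSeqUpTo_of_le {k : ℕ} (s : P.game.Strategy i) (σ : P.game.OppStrategy i)
    {e : Fin P.T × OutcomeKind} (he : k ≤ e.1.1) : outcomeSeqUpTo k s σ e = noOutcome e.2 :=
  if_neg (Nat.not_le_of_lt (Nat.lt_succ_of_le he))

theorem outcomeSeq_of_isOver (s : P.game.Strategy i) (σ : P.game.OppStrategy i)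
    {e : Fin P.T × OutcomeKind} (h : P.isOver (path s σ e.1.1)) :
    outcomeSeq s σ e = noOutcome e.2 := by
  obtain ⟨t, _ | _ | _⟩ := e <;> exact if_pos h

theorem outcomeSeq_upper (s : P.game.Strategy i) (σ : P.game.OppStrategy i) {t : Fin P.T}
    (h : P.isOver (path s σ t.1) = false) :
    outcomeSeq s σ (t, .upper) = (some (profile s σ (t.1 + 1) i) : Option ℕ) :=
  if_neg (ne_true_of_eq_false h)

theorem outcomeSeq_lower (s : P.game.Strategy i) (σ : P.game.OppStrategy i) {t : Fin P.T}
    (h : P.isOver (path s σ t.1) = false) :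
    outcomeSeq s σ (t, .lower) = (some (min (profile s σ (t.1 + 1) i)
      (P.clinched i (profile s σ (t.1 + 1)))) : Option ℕ) :=
  if_neg (ne_true_of_eq_false h)

theorem outcomeSeq_excess (s : P.game.Strategy i) (σ : P.game.OppStrategy i) {t : Fin P.T}
    (h : P.isOver (path s σ t.1) = false) :
    outcomeSeq s σ (t, .excess) = (some (P.rationed (P.order (nature σ) (t.1 + 1))
      (profile s σ t.1) (profile s σ (t.1 + 1)) i) : Option ℤ) := by
  refine (if_neg (ne_true_of_eq_false h)).trans ?_
  change (some (P.rationed (P.order (nature σ) ((path s σ t.1).length + 1)) _ _ i) : Option ℤ) = _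
  rw [length_path]
  rfl

theorem outcomeSeq_ne (s : P.game.Strategy i) (σ : P.game.OppStrategy i)
    {e : Fin P.T × OutcomeKind} (h : P.isOver (path s σ e.1.1) = false) :
    outcomeSeq s σ e ≠ noOutcome e.2 := by
  obtain ⟨t, _ | _ | _⟩ := e
  · rw [outcomeSeq_upper s σ h]; exact Option.some_ne_none _
  · rw [outcomeSeq_lower s σ h]; exact Option.some_ne_none _
  · rw [outcomeSeq_excess s σ h]; exact Option.some_ne_none _

theorem not_isOver_of_le {s : P.game.Strategy i} {σ : P.game.OppStrategy i} {k m : ℕ}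
    (hm : P.isOver (path s σ m) = false) (hkm : k ≤ m) : P.isOver (path s σ k) = false := by
  by_contra h
  rw [Bool.not_eq_false] at h
  rw [isOver_path_mono s σ hkm h] at hm
  exact absurd hm (by simp)

theorem le_lastRound_outcomeSeq {s : P.game.Strategy i} {σ : P.game.OppStrategy i} {m : ℕ}
    (hmT : m < P.T) (hm : P.isOver (path s σ m) = false) : m + 1 ≤ lastRound (outcomeSeq s σ) :=
  le_lastRound hmT fun _ _ ht => outcomeSeq_ne s σ (not_isOver_of_le hm (Nat.le_of_lt_succ ht))

theorem not_isOver_of_lt_lastRound {s : P.game.Strategy i} {σ : P.game.OppStrategy i} {m : ℕ}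
    (hm : m < lastRound (outcomeSeq s σ)) : P.isOver (path s σ m) = false := by
  by_contra h
  rw [Bool.not_eq_false] at h
  have hT : m < P.T := hm.trans_le (lastRound_le _)
  exact ne_noOutcome_of_lt_lastRound _ ⟨m, hT⟩ .upper hm
    (outcomeSeq_of_isOver s σ (e := (⟨m, hT⟩, .upper)) h)

theorem lastRound_upTo {s : P.game.Strategy i} {σ : P.game.OppStrategy i} {m : ℕ}
    (hmT : m < P.T) (hm : P.isOver (path s σ m) = false) :
    lastRound (outcomeSeqUpTo (m + 1) s σ) = m + 1 := by
  apply le_antisymm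
  · by_contra! hlt
    have hT := hlt.trans_le (lastRound_le _)
    exact ne_noOutcome_of_lt_lastRound _ ⟨m + 1, hT⟩ .upper hlt (outcomeSeqUpTo_of_le s σ le_rfl)
  · refine le_lastRound hmT fun t k ht => ?_
    rw [outcomeSeqUpTo_of_lt s σ ht]
    exact outcomeSeq_ne s σ (not_isOver_of_le hm (Nat.le_of_lt_succ ht))

theorem lowerAt_outcomeSeq {s : P.game.Strategy i} {σ : P.game.OppStrategy i} {m : ℕ}
    (hmT : m < P.T) (hm : P.isOver (path s σ m) = false) :
    lowerAt (outcomeSeq s σ) (m + 1) =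
      min (profile s σ (m + 1) i) (P.clinched i (profile s σ (m + 1))) :=
  lowerAt_eq (t := ⟨m, hmT⟩) (outcomeSeq_lower s σ hm)

theorem upperAt_outcomeSeq {s : P.game.Strategy i} {σ : P.game.OppStrategy i} {m : ℕ}
    (hmT : m ≤ P.T) (hm : P.isOver (path s σ (m - 1)) = false) :
    upperAt i (outcomeSeq s σ) m = profile s σ m i := by
  cases m with
  | zero => rfl
  | succ m => exact upperAt_eq i (t := ⟨m, hmT⟩) (outcomeSeq_upper s σ hm)

theorem excessAt_outcomeSeq {s : P.game.Strategy i} {σ : P.game.OppStrategy i} {m : ℕ}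
    (hmT : m < P.T) (hm : P.isOver (path s σ m) = false) :
    excessAt (outcomeSeq s σ) (m + 1) =
      P.rationed (P.order (nature σ) (m + 1)) (profile s σ m) (profile s σ (m + 1)) i :=
  excessAt_eq (t := ⟨m, hmT⟩) (outcomeSeq_excess s σ hm)

theorem lowerAt_upTo {s : P.game.Strategy i} {σ : P.game.OppStrategy i} {k r : ℕ} (h : r ≤ k) :
    lowerAt (outcomeSeqUpTo k s σ) r = lowerAt (outcomeSeq s σ) r :=
  lowerAt_congr fun _ ht => outcomeSeqUpTo_of_lt s σ (Nat.lt_of_succ_le (ht.trans_le h))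

theorem upperAt_upTo {s : P.game.Strategy i} {σ : P.game.OppStrategy i} {k r : ℕ} (h : r ≤ k) :
    upperAt i (outcomeSeqUpTo k s σ) r = upperAt i (outcomeSeq s σ) r :=
  upperAt_congr i fun _ ht => outcomeSeqUpTo_of_lt s σ (Nat.lt_of_succ_le (ht.trans_le h))

theorem excessAt_upTo {s : P.game.Strategy i} {σ : P.game.OppStrategy i} {k r : ℕ} (h : r ≤ k) :
    excessAt (outcomeSeqUpTo k s σ) r = excessAt (outcomeSeq s σ) r :=
  excessAt_congr fun _ ht => outcomeSeqUpTo_of_lt s σ (Nat.lt_of_succ_le (ht.trans_le h))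

/-! ### Sequential rationing and residual supply. -/

theorem sum_before_add_sum_after (π : Equiv.Perm (Fin n)) (i : Fin n) (f : Fin n → ℤ) :
    ∑ j ∈ Finset.univ.filter (fun j => π j < π i), f j +
      ∑ j ∈ Finset.univ.filter (fun j => π i < π j), f j = ∑ j ∈ Finset.univ.erase i, f j := by
  rw [← Finset.sum_union]
  · refine Finset.sum_congr ?_ fun _ _ => rfl
    ext j
    simp only [Finset.mem_union, Finset.mem_filter, Finset.mem_univ, true_and, Finset.mem_erase,
      and_true, lt_or_lt_iff_ne]
    exact π.injective.ne_iff
  · rw [Finset.disjoint_filter]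
    exact fun _ _ h => h.not_gt

/-- Bidder `i` is neither before nor after herself, so her own bids enter neither sum. -/
theorem rationed_congr (π : Equiv.Perm (Fin n)) {b b' x x' : Fin n → ℕ}
    (hb : ∀ j, j ≠ i → b' j = b j) (hx : ∀ j, j ≠ i → x' j = x j) :
    P.rationed π b' x' i = P.rationed π b x i := by
  unfold rationed
  congr 1
  · congr 1
    refine Finset.sum_congr rfl fun j hj => ?_
    rw [hb j (by rintro rfl; simp at hj)]
  · refine Finset.sum_congr rfl fun j hj => ?_
    rw [hx j (by rintro rfl; simp at hj)]

/-- Lowering the bids of those before `i` to their current values can only free units. With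
`le_rationed`, the rationed quantity lies between the residual supplies at the previous and at the
current bids. -/
theorem rationed_le (π : Equiv.Perm (Fin n)) {b' b : Fin n → ℕ} (h : ∀ j, b j ≤ b' j) :
    P.rationed π b' b i ≤ (P.M : ℤ) - (∑ j ∈ Finset.univ.erase i, b j : ℕ) := by
  have h1 := sum_before_add_sum_after π i fun j => (b j : ℤ)
  have h2 : ∑ j ∈ Finset.univ.filter (fun j => π j < π i), (b j : ℤ) ≤
      ∑ j ∈ Finset.univ.filter (fun j => π j < π i), (b' j : ℤ) :=
    Finset.sum_le_sum fun j _ => Nat.cast_le.mpr (h j)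
  unfold rationed
  push_cast
  linarith

theorem le_rationed (π : Equiv.Perm (Fin n)) {b' b : Fin n → ℕ} (h : ∀ j, b j ≤ b' j) :
    (P.M : ℤ) - (∑ j ∈ Finset.univ.erase i, b' j : ℕ) ≤ P.rationed π b' b i := by
  have h1 := sum_before_add_sum_after π i fun j => (b' j : ℤ)
  have h2 : ∑ j ∈ Finset.univ.filter (fun j => π i < π j), (b j : ℤ) ≤
      ∑ j ∈ Finset.univ.filter (fun j => π i < π j), (b' j : ℤ) :=
    Finset.sum_le_sum fun j _ => Nat.cast_le.mpr (h j)
  unfold rationed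
  push_cast
  linarith

/-- The sum of the opponents' bids in round `m`. -/
noncomputable def others (s : P.game.Strategy i) (σ : P.game.OppStrategy i) (m : ℕ) : ℕ :=
  ∑ j ∈ Finset.univ.erase i, profile s σ m j

theorem clinched_profile (s : P.game.Strategy i) (σ : P.game.OppStrategy i) (m : ℕ) :
    P.clinched i (profile s σ m) = P.M - others s σ m := rfl

theorem others_anti (s : P.game.Strategy i) (σ : P.game.OppStrategy i) {k m : ℕ} (hkm : k ≤ m)
    (hm : m ≤ P.T) : others s σ m ≤ others s σ k :=
  Finset.sum_le_sum fun j _ => profile_anti s σ hkm hm j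

theorem isOver_succ_iff (s : P.game.Strategy i) (σ : P.game.OppStrategy i) (m : ℕ) :
    P.isOver (path s σ (m + 1)) = true ↔
      P.isOver (path s σ m) = true ∨ profile s σ (m + 1) i + others s σ (m + 1) ≤ P.M := by
  rw [isOver_path_succ, sum_eq_add_others i, Bool.or_eq_true, decide_eq_true_iff]
  rfl

/-- Bids never rise, so if the opponents alone exceed the supply in round `m`, they did so in every
earlier round. -/
theorem not_isOver_of_lt_others {s : P.game.Strategy i} {σ : P.game.OppStrategy i} {m : ℕ}
    (hm : m ≤ P.T) (h : P.M < others s σ m) : P.isOver (path s σ m) = false := by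
  induction m with
  | zero => rfl
  | succ m ih =>
    have h1 := ih (Nat.le_of_succ_le hm) (h.trans_le (others_anti s σ (Nat.le_succ m) hm))
    rw [← Bool.not_eq_true, isOver_succ_iff, h1]
    simp only [Bool.false_eq_true, false_or, not_le]
    omega

theorem lowerAt_eq_zero_of_lt_others {s : P.game.Strategy i} {σ : P.game.OppStrategy i} {r m : ℕ}
    (hrm : r ≤ m) (hm : m ≤ P.T) (h : P.M < others s σ m) : lowerAt (outcomeSeq s σ) r = 0 := by
  cases r with
  | zero => rfl
  | succ r =>
    have h1 := others_anti s σ hrm hm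
    have h2 := others_anti s σ ((Nat.le_succ r).trans hrm) hm
    rw [lowerAt_outcomeSeq (by omega) (not_isOver_of_lt_others (by omega) (h.trans_le h2)),
      clinched_profile]
    omega

theorem quantity_outcomeSeq {s : P.game.Strategy i} {σ : P.game.OppStrategy i} {m : ℕ}
    (hm : lastRound (outcomeSeq s σ) = m + 1) :
    quantity i (outcomeSeq s σ) =
      max (min (profile s σ (m + 1) i) (P.M - others s σ (m + 1))) (min (profile s σ m i)
        (P.rationed (P.order (nature σ) (m + 1)) (profile s σ m) (profile s σ (m + 1)) i).toNat) := by
  have hmT : m < P.T := by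
    have := lastRound_le (outcomeSeq s σ)
    omega
  have ho : P.isOver (path s σ m) = false := not_isOver_of_lt_lastRound (by omega)
  rw [quantity, hm, if_neg (Nat.succ_ne_zero m), Nat.add_sub_cancel, lowerAt_outcomeSeq hmT ho,
    excessAt_outcomeSeq hmT ho, upperAt_outcomeSeq hmT.le (not_isOver_of_le ho (Nat.sub_le m 1)),
    clinched_profile]

theorem quantity_upTo {s : P.game.Strategy i} {σ : P.game.OppStrategy i} {m : ℕ}
    (hmT : m < P.T) (ho : P.isOver (path s σ m) = false) :
    quantity i (outcomeSeqUpTo (m + 1) s σ) =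
      max (min (profile s σ (m + 1) i) (P.M - others s σ (m + 1))) (min (profile s σ m i)
        (P.rationed (P.order (nature σ) (m + 1)) (profile s σ m) (profile s σ (m + 1)) i).toNat) := by
  rw [quantity, lastRound_upTo hmT ho, if_neg (Nat.succ_ne_zero m), Nat.add_sub_cancel,
    lowerAt_upTo le_rfl, excessAt_upTo le_rfl, upperAt_upTo (Nat.le_succ m),
    lowerAt_outcomeSeq hmT ho,
    excessAt_outcomeSeq hmT ho, upperAt_outcomeSeq hmT.le (not_isOver_of_le ho (Nat.sub_le m 1)),
    clinched_profile]

theorem utility_upTo {s : P.game.Strategy i} {σ : P.game.OppStrategy i} {m : ℕ} (hmT : m < P.T)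
    (ho : P.isOver (path s σ m) = false) {q : ℕ}
    (hq : quantity i (outcomeSeqUpTo (m + 1) s σ) = q) :
    utility i (nature σ) (outcomeSeqUpTo (m + 1) s σ) =
      (P.val (nature σ) i).1 q - P.p (m + 1) * q +
        ∑ t ∈ Finset.Icc 1 m, (P.p (t + 1) - P.p t) * (lowerAt (outcomeSeq s σ) t : ℝ) := by
  rw [utility_eq, hq, lastRound_upTo hmT ho, Nat.add_sub_cancel]
  congr 1
  refine Finset.sum_congr rfl fun t ht => ?_
  rw [lowerAt_upTo ((Finset.mem_Icc.mp ht).2.trans (Nat.le_succ m))]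

theorem utility_eq_zero {θ : P.State} {y : P.OutcomeSeq} (hq : quantity i y = 0)
    (hL : ∀ r < lastRound y, lowerAt y r = 0) : utility i θ y = 0 := by
  rw [utility_eq, hq, (P.val θ i).2.1, Finset.sum_eq_zero]
  · simp
  · intro r hr
    have := Finset.mem_Icc.mp hr
    rw [hL r (by omega)]
    simp

/-- Residual supply is negative throughout, so nothing was secured earlier, and the rationed
quantity, bounded by `rationed_le`, truncates to `0`. -/
theorem utility_upTo_eq_zero {s : P.game.Strategy i} {σ : P.game.OppStrategy i} {m : ℕ}
    (hmT : m < P.T) (h : P.M < others s σ (m + 1)) :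
    utility i (nature σ) (outcomeSeqUpTo (m + 1) s σ) = 0 := by
  have ho : P.isOver (path s σ m) = false :=
    not_isOver_of_le (not_isOver_of_lt_others hmT h) (Nat.le_succ m)
  apply utility_eq_zero
  · have hr := rationed_le (P := P) (i := i) (P.order (nature σ) (m + 1))
      fun j => profile_succ_le s σ hmT j
    change _ ≤ (P.M : ℤ) - (others s σ (m + 1) : ℕ) at hr
    rw [quantity_upTo hmT ho]
    omega
  · intro r hr
    rw [lastRound_upTo hmT ho] at hr
    rw [lowerAt_upTo hr.le, lowerAt_eq_zero_of_lt_others hr.le hmT h]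

/-- A bidder who bids `0` while the others demand more than the supply gets nothing. -/
theorem utility_outcomeSeq_eq_zero {s : P.game.Strategy i} {σ : P.game.OppStrategy i} {m : ℕ}
    (hmT : m < P.T) (h : P.M < others s σ m) (h0 : profile s σ m i = 0) :
    utility i (nature σ) (outcomeSeq s σ) = 0 := by
  have hτ := le_lastRound_outcomeSeq hmT (not_isOver_of_lt_others hmT.le h)
  have hτT := lastRound_le (outcomeSeq s σ)
  have hbid : ∀ k, m ≤ k → k ≤ P.T → profile s σ k i = 0 := fun k hk hkT =>
    Nat.le_zero.mp (h0 ▸ profile_anti s σ hk hkT i)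
  apply utility_eq_zero
  · obtain ⟨k, hk⟩ : ∃ k, lastRound (outcomeSeq s σ) = k + 1 :=
      ⟨lastRound (outcomeSeq s σ) - 1, by omega⟩
    rw [quantity_outcomeSeq hk, hbid k (by omega) (by omega), hbid (k + 1) (by omega) (by omega)]
    simp
  · intro r hr
    rcases le_or_gt r m with hrm | hrm
    · exact lowerAt_eq_zero_of_lt_others hrm hmT.le h
    · obtain ⟨k, rfl⟩ : ∃ k, r = k + 1 := ⟨r - 1, by omega⟩
      rw [lowerAt_outcomeSeq (by omega) (not_isOver_of_lt_lastRound (by omega)),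
        hbid (k + 1) (by omega) (by omega)]
      simp

theorem path_eq_of_le {s s' : P.game.Strategy i} {σ : P.game.OppStrategy i} {k m : ℕ} (hkm : k ≤ m)
    (h : path s σ m = path s' σ m) : path s σ k = path s' σ k := by
  induction m, hkm using Nat.le_induction with
  | base => exact h
  | succ m _ ih =>
    rw [path_succ, path_succ] at h
    exact ih (List.cons.inj h).2

theorem lowerAt_eq_of_path_eq {s s' : P.game.Strategy i} {σ : P.game.OppStrategy i} {r m : ℕ}
    (hrm : r ≤ m) (h : path s σ m = path s' σ m) :
    lowerAt (outcomeSeq s σ) r = lowerAt (outcomeSeq s' σ) r := by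
  refine lowerAt_congr fun t ht => ?_
  rw [outcomeSeq_apply, outcomeSeq_apply, path_eq_of_le (show t.1 + 1 ≤ m by omega) h]

theorem outcomeSeq_eq_upTo_of_isOver {s : P.game.Strategy i} {σ : P.game.OppStrategy i} {m : ℕ}
    (h : P.isOver (path s σ m)) : outcomeSeq s σ = outcomeSeqUpTo m s σ := by
  funext e
  rcases lt_or_ge e.1.1 m with he | he
  · rw [outcomeSeqUpTo_of_lt s σ he]
  · rw [outcomeSeqUpTo_of_le s σ he, outcomeSeq_of_isOver s σ (isOver_path_mono s σ he h)]

/-- If a bidder bids `0` from some round on, then the units she still has to buy are bought in that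
round; if she demands them at its price, this is better than having stopped before. -/
theorem utility_upTo_le_of_bid_zero {s : P.game.Strategy i} {σ : P.game.OppStrategy i} {m d : ℕ}
    (hmT : m + 1 < P.T) (hd : P.IsDemand i (P.val (nature σ) i) (P.p (m + 2)) d)
    (hcd : profile s σ (m + 1) i ≤ d) (h0 : profile s σ (m + 2) i = 0)
    (hover : P.isOver (path s σ (m + 1)) = false) :
    utility i (nature σ) (outcomeSeqUpTo (m + 1) s σ) ≤ utility i (nature σ) (outcomeSeq s σ) := by
  have ho : P.isOver (path s σ m) = false := not_isOver_of_le hover (Nat.le_succ m)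
  have hsum : P.M < profile s σ (m + 1) i + others s σ (m + 1) := by
    by_contra! hle
    rw [(isOver_succ_iff s σ m).mpr (Or.inr hle)] at hover
    exact absurd hover (by simp)
  have hτ := le_lastRound_outcomeSeq hmT hover
  have hτT := lastRound_le (outcomeSeq s σ)
  rcases hτ.eq_or_lt with hτ | hτ
  · have hr := rationed_le (P := P) (i := i) (P.order (nature σ) (m + 1))
      fun j => profile_succ_le s σ (Nat.lt_of_succ_lt hmT) j
    change _ ≤ (P.M : ℤ) - (others s σ (m + 1) : ℕ) at hr
    have hr' : (P.M : ℤ) - (others s σ (m + 1) : ℕ) ≤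
        P.rationed (P.order (nature σ) (m + 2)) (profile s σ (m + 1)) (profile s σ (m + 2)) i :=
      le_rationed _ fun j => profile_succ_le s σ hmT j
    -- The auction goes on, so her bid exceeds the residual supply; that supply is secured, and
    -- rationing cannot give more.
    have hq : quantity i (outcomeSeqUpTo (m + 1) s σ) = P.M - others s σ (m + 1) := by
      rw [quantity_upTo (Nat.lt_of_succ_lt hmT) ho]
      omega
    have hQ := quantity_outcomeSeq hτ.symm
    rw [show m + 1 + 1 = m + 2 from rfl, h0] at hQ
    have hL : lowerAt (outcomeSeq s σ) (m + 1) = P.M - others s σ (m + 1) := by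
      rw [lowerAt_outcomeSeq (Nat.lt_of_succ_lt hmT) ho, clinched_profile]
      omega
    rw [utility_upTo (Nat.lt_of_succ_lt hmT) ho hq, utility_eq, ← hτ, Nat.add_sub_cancel,
      Finset.sum_Icc_succ_top (Nat.le_add_left 1 m), hL]
    -- The units secured in round `m + 1` contribute their number times `p (m + 2) - p (m + 1)` to
    -- the savings, so what remains is to compare the surpluses of the two quantities at price `p (m
    -- + 2)`.
    have := surplus_mono hd le_rfl
      (show P.M - others s σ (m + 1) ≤ quantity i (outcomeSeq s σ) by omega)
      (show quantity i (outcomeSeq s σ) ≤ d by omega)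
    rw [show m + 1 + 1 = m + 2 from rfl]
    linarith
  -- The auction outlasts her bid of `0`, so the opponents alone exceed the supply and both
  -- utilities are `0`.
  · have hover' : P.isOver (path s σ (m + 2)) = false := not_isOver_of_lt_lastRound hτ
    have hsum' : P.M < others s σ (m + 2) := by
      by_contra! hle
      rw [(isOver_succ_iff s σ (m + 1)).mpr (Or.inr (by rwa [h0, zero_add]))] at hover'
      exact absurd hover' (by simp)
    rw [utility_outcomeSeq_eq_zero (by omega) hsum' h0, utility_upTo_eq_zero (by omega)
      (hsum'.trans_le (others_anti s σ (Nat.le_succ _) hmT))]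

/-! ### Mimicking the continuation after a lower bid. -/

theorem isOver_append_congr {l₁ l₂ : List (Fin n → ℕ)} (h : P.isOver l₁ = P.isOver l₂)
    (r : List (Fin n → ℕ)) : P.isOver (r ++ l₁) = P.isOver (r ++ l₂) := by
  induction r with
  | nil => exact h
  | cons b r ih => simp only [List.cons_append, isOver, ih]

/-- The observations made after two histories that are equally over have a common continuation. -/
theorem observe_append {l₁ l₂ : List (Fin n → ℕ)} (h : P.isOver l₁ = P.isOver l₂) (j : Fin n)
    (θ : P.State) (r : List (Fin n → ℕ)) : ∃ R : List (ℕ × Bool), R.length = r.length ∧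
      (P.observe j θ (r ++ l₁)).2 = R ++ (P.observe j θ l₁).2 ∧
      (P.observe j θ (r ++ l₂)).2 = R ++ (P.observe j θ l₂).2 := by
  induction r with
  | nil => exact ⟨[], rfl, rfl, rfl⟩
  | cons b r ih =>
    obtain ⟨R, h0, h1, h2⟩ := ih
    refine ⟨(b j, P.isOver (b :: (r ++ l₁))) :: R, by simp [h0], ?_, ?_⟩
    · simp only [List.cons_append, observe, h1]
    · have := isOver_append_congr h (b :: r)
      simp only [List.cons_append] at this
      simp only [List.cons_append, observe, h2, this]

/-- The information set of a later stage that differs in that the bid at `h` was `b`. -/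
def relabel (h : BidderValuation × List (ℕ × Bool)) (b : ℕ) (x : BidderValuation × List (ℕ × Bool)) :
    BidderValuation × List (ℕ × Bool) :=
  (x.1, x.2.take (x.2.length - (h.2.length + 1)) ++ (b, false) :: h.2)

/-- The strategy that chooses `c` at `h` and then does what `s` does after `b`. -/
noncomputable def mimic (s : P.game.Strategy i) (h : BidderValuation × List (ℕ × Bool)) (c b : ℕ) :
    P.game.Strategy i :=
  deviate s h c fun x => bidOf s (relabel h b x)

theorem observe_path_succ (s : P.game.Strategy i) (σ : P.game.OppStrategy i) (j : Fin n) (m : ℕ) :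
    P.observe j (nature σ) (path s σ (m + 1)) = (P.val (nature σ) j,
      (profile s σ (m + 1) j, P.isOver (path s σ (m + 1))) ::
        (P.observe j (nature σ) (path s σ m)).2) := rfl

section Mimic

variable {h : BidderValuation × List (ℕ × Bool)} {b c : ℕ} {s : P.game.Strategy i}
  {σ : P.game.OppStrategy i}

/-- Opponents see their own bids and whether the auction is over, and these agree on both paths, so
they bid alike. Bidder `i`'s records differ only in the entry for `h`, which `relabel` repairs. -/
theorem profile_mimic (hs : s ∈ ownStrategies (G := P.game) (i := i) h b) (hc : c ∈ P.bids i h)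
    (hbc : b ≤ c) (hσ : σ ∈ oppStrategies (G := P.game) (i := i) h)
    (ho : P.isOver (path s σ (h.2.length + 1)) = false)
    (ho' : P.isOver (path (mimic s h c b) σ (h.2.length + 1)) = false) {m : ℕ} (hm : m < P.T)
    {r : List (Fin n → ℕ)} (hr : path s σ m = r ++ path s σ (h.2.length + 1))
    (hr' : path (mimic s h c b) σ m = r ++ path (mimic s h c b) σ (h.2.length + 1)) :
    profile (mimic s h c b) σ (m + 1) = profile s σ (m + 1) := by
  have hs' : mimic s h c b ∈ ownStrategies (G := P.game) (i := i) h c :=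
    deviate_mem_ownStrategies hs hc _
  have hoo := ho.trans ho'.symm
  have hlen : m = r.length + (h.2.length + 1) := by
    rw [← length_path s σ m, hr, List.length_append, length_path]
  funext j
  by_cases hj : j = i
  · subst hj
    rw [profile_succ_self, profile_succ_self]
    obtain ⟨R, h0, h1, h2⟩ := observe_append hoo j (nature σ) r
    rw [← hr, observe_path_succ s, profile_self_of_mem hs hσ, ho] at h1
    rw [← hr', observe_path_succ, profile_self_of_mem hs' hσ, ho'] at h2
    change _ = R ++ (b, false) :: (observed s σ h.2.length).2 at h1
    change _ = R ++ (c, false) :: (observed (mimic s h c b) σ h.2.length).2 at h2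
    rw [observed_of_mem hs hσ] at h1
    rw [observed_of_mem hs' hσ] at h2
    -- `R` collects the entries made after the stage of `h`, and `relabel` keeps exactly these.
    have key : relabel h b (observed (mimic s h c b) σ m) = observed s σ m := by
      refine Prod.ext ((observe_fst j _ _).trans (observe_fst j _ _).symm) ?_
      change List.take _ (observed (mimic s h c b) σ m).2 ++ _ = (observed s σ m).2
      rw [length_observed, show m - (h.2.length + 1) = R.length by omega]
      have h1 : (observed s σ m).2 = _ := h1
      have h2 : (observed (mimic s h c b) σ m).2 = _ := h2
      rw [h1, h2, List.take_left]
    refine (bidOf_deviate_after s c ?_ ?_).trans (congrArg (bidOf s) key)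
    · rw [length_observed]
      omega
    · rw [key]
      have hmem := bidOf_mem_bids s σ hm
      have hover : P.isOver (path (mimic s h c b) σ m) = P.isOver (path s σ m) := by
        rw [hr, hr']
        exact (isOver_append_congr hoo r).symm
      -- The copied bid must be available: right after `h` the bounds are `b ≤ c`, and in later
      -- rounds they coincide.
      have hlast : profile s σ m j ≤ profile (mimic s h c b) σ m j := by
        rw [profile, profile, hr, hr']
        cases r with
        | nil =>
          change profile s σ _ j ≤ profile (mimic s h c b) σ _ j
          rw [profile_self_of_mem hs hσ, profile_self_of_mem hs' hσ]
          exact hbc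
        | cons => exact le_rfl
      rw [observed, bids_observe, hover]
      have hmem : bidOf s (observed s σ m) ∈ P.bids j (P.observe j (nature σ) (path s σ m)) := hmem
      rw [bids_observe] at hmem
      split_ifs at hmem ⊢ with hx
      · exact hmem
      · exact Set.mem_Iic.mpr ((Set.mem_Iic.mp hmem).trans hlast)
  · rw [profile_succ_of_ne _ _ _ hj, profile_succ_of_ne _ _ _ hj]
    obtain ⟨R, -, h1, h2⟩ := observe_append hoo j (nature σ) r
    refine congrArg (σ.2 ⟨j, hj⟩).1
      (Prod.ext ((observe_fst j _ _).trans (observe_fst j _ _).symm) ?_)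
    rw [hr, hr', h1, h2, observe_path_succ, observe_path_succ, path_of_mem hs' hs hσ,
      profile_ne_of_mem hs' hs hσ hj, ho, ho']

theorem path_mimic (hs : s ∈ ownStrategies (G := P.game) (i := i) h b) (hc : c ∈ P.bids i h)
    (hbc : b ≤ c) (hσ : σ ∈ oppStrategies (G := P.game) (i := i) h)
    (ho : P.isOver (path s σ (h.2.length + 1)) = false)
    (ho' : P.isOver (path (mimic s h c b) σ (h.2.length + 1)) = false) {m : ℕ}
    (hhm : h.2.length + 1 ≤ m) (hm : m ≤ P.T) :
    ∃ r, path s σ m = r ++ path s σ (h.2.length + 1) ∧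
      path (mimic s h c b) σ m = r ++ path (mimic s h c b) σ (h.2.length + 1) := by
  induction m, hhm using Nat.le_induction with
  | base => exact ⟨[], rfl, rfl⟩
  | succ m _ ih =>
    obtain ⟨r, h1, h2⟩ := ih (Nat.le_of_succ_le hm)
    refine ⟨profile s σ (m + 1) :: r, ?_, ?_⟩
    · rw [path_succ, h1]
      rfl
    · rw [path_succ, profile_mimic hs hc hbc hσ ho ho' hm h1 h2, h2]
      rfl

theorem outcomeSeq_mimic (hs : s ∈ ownStrategies (G := P.game) (i := i) h b) (hc : c ∈ P.bids i h)
    (hbc : b ≤ c) (hσ : σ ∈ oppStrategies (G := P.game) (i := i) h)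
    (ho : P.isOver (path s σ (h.2.length + 1)) = false)
    (ho' : P.isOver (path (mimic s h c b) σ (h.2.length + 1)) = false)
    {e : Fin P.T × OutcomeKind} (he : h.2.length + 1 ≤ e.1.1) :
    outcomeSeq (mimic s h c b) σ e = outcomeSeq s σ e := by
  have hs' : mimic s h c b ∈ ownStrategies (G := P.game) (i := i) h c :=
    deviate_mem_ownStrategies hs hc _
  obtain ⟨r, h1, h2⟩ := path_mimic hs hc hbc hσ ho ho' he e.1.2.le
  have hp := profile_mimic hs hc hbc hσ ho ho' e.1.2 h1 h2
  have hover : P.isOver (path (mimic s h c b) σ e.1.1) = P.isOver (path s σ e.1.1) := by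
    rw [h1, h2]
    exact (isOver_append_congr (ho.trans ho'.symm) r).symm
  cases hx : P.isOver (path s σ e.1.1) with
  | true =>
    rw [hx] at hover
    rw [outcomeSeq_of_isOver s σ hx, outcomeSeq_of_isOver _ σ hover]
  | false =>
    rw [hx] at hover
    -- In the round right after `h` the previous profiles still differ, but only in `i`'s own bid,
    -- which her rationed quantity ignores.
    have hlast : ∀ j, j ≠ i → profile (mimic s h c b) σ e.1.1 j = profile s σ e.1.1 j := by
      intro j hj
      rw [profile, profile, h1, h2]
      cases r with
      | nil => exact profile_ne_of_mem hs' hs hσ hj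
      | cons => rfl
    obtain ⟨t, _ | _ | _⟩ := e
    · rw [outcomeSeq_upper _ σ hx, outcomeSeq_upper _ σ hover, hp]
    · rw [outcomeSeq_lower _ σ hx, outcomeSeq_lower _ σ hover, hp]
    · rw [outcomeSeq_excess _ σ hx, outcomeSeq_excess _ σ hover, hp,
        rationed_congr _ hlast fun _ _ => rfl]

end Mimic

/-! ### The two conditions of local stage dominance, scenario by scenario. -/

variable {h : BidderValuation × List (ℕ × Bool)} {b c d : ℕ}

theorem isOver_path_iff_of_mem {a : ℕ} {s : P.game.Strategy i} {σ : P.game.OppStrategy i}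
    (hc : c ∈ P.bids i h) (hpos : 0 < c) (hs : s ∈ ownStrategies (G := P.game) (i := i) h a)
    (hσ : σ ∈ oppStrategies (G := P.game) (i := i) h) :
    P.isOver (path s σ (h.2.length + 1)) = true ↔ a + others s σ (h.2.length + 1) ≤ P.M := by
  rw [isOver_succ_iff, not_isOver_of_mem hc hpos hs hσ, profile_self_of_mem hs hσ]
  simp

/-- Where bidder `i` is never active again after either bid, later outcomes are dummies. -/
theorem locallyRelevant_of_subset_ending (hT : h.2.length + 1 < P.T) (hc : c ∈ P.bids i h)
    (hbc : b < c) {S : Set (P.game.OppStrategy i)}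
    (hS : S ⊆ ending (G := P.game) (i := i) h c) :
    LocallyRelevant (G := P.game) (i := i) h c b S := by
  have hpos : 0 < c := by omega
  intro s hs
  -- Any continuation would do, since mimicking is vacuous when `i` is never active again.
  have hs' := deviate_mem_ownStrategies hs hc fun _ => 0
  refine ⟨deviate s h c fun _ => 0, hs', ?_, ?_⟩
  · rintro σ hσ m hm ⟨k, hk, hkm, hact⟩
    exact ((hS hσ).2 _ hs' k hk (hkm.trans_lt hm) hact).elim
  · intro σ hσ e he
    have he : h.2.length + 1 ≤ e.1.1 := Nat.le_of_lt_succ he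
    have hopp := (hS hσ).1
    have hend := (mem_ending_iff hc hpos hT hs' hopp).mp (hS hσ)
    have hK : others (deviate s h c fun _ => 0) σ (h.2.length + 1) = others s σ (h.2.length + 1) :=
      others_of_mem hs' hs hopp
    have hle : c + others (deviate s h c fun _ => 0) σ (h.2.length + 1) ≤ P.M :=
      hend.resolve_left hpos.ne'
    have h1 := (isOver_path_iff_of_mem hc hpos hs' hopp).mpr hle
    have h2 := (isOver_path_iff_of_mem hc hpos hs hopp).mpr (by omega)
    exact (outcomeSeq_of_isOver _ σ (e := e) (isOver_path_mono _ σ he h1)).trans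
      (outcomeSeq_of_isOver _ σ (e := e) (isOver_path_mono _ σ he h2)).symm

/-- Where bidder `i` is active again after the lower bid, what she does then can be mimicked after
the higher bid. -/
theorem locallyRelevant_of_disjoint_ending (hT : h.2.length + 1 < P.T) (hc : c ∈ P.bids i h)
    (hbc : b < c) {S : Set (P.game.OppStrategy i)}
    (hS : S ⊆ oppStrategies (G := P.game) (i := i) h)
    (hSb : ∀ σ ∈ S, σ ∉ ending (G := P.game) (i := i) h b) :
    LocallyRelevant (G := P.game) (i := i) h c b S := by
  have hpos : 0 < c := by omega
  intro s hs
  have hs' : mimic s h c b ∈ ownStrategies (G := P.game) (i := i) h c :=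
    deviate_mem_ownStrategies hs hc _
  have hover : ∀ σ ∈ S, P.isOver (path s σ (h.2.length + 1)) = false ∧
      P.isOver (path (mimic s h c b) σ (h.2.length + 1)) = false := by
    intro σ hσ
    have hend := mt (mem_ending_iff hc hpos hT hs (hS hσ)).mpr (hSb σ hσ)
    have hK : others (mimic s h c b) σ (h.2.length + 1) = others s σ (h.2.length + 1) :=
      others_of_mem hs' hs (hS hσ)
    have hlt : ¬ b + others s σ (h.2.length + 1) ≤ P.M := fun hle => hend (Or.inr hle)
    constructor
    · rwa [← Bool.not_eq_true, isOver_path_iff_of_mem hc hpos hs (hS hσ)]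
    · rw [← Bool.not_eq_true, isOver_path_iff_of_mem hc hpos hs' (hS hσ)]
      omega
  refine ⟨mimic s h c b, hs', ?_, ?_⟩
  · rintro σ hσ m hm ⟨k, hk, hkm, -⟩
    have hm : m < P.T := hm
    obtain ⟨ho, ho'⟩ := hover σ hσ
    obtain ⟨r, h1, h2⟩ := path_mimic hs hc hbc.le (hS hσ) ho ho' (hk.trans hkm) hm.le
    have := congrFun (profile_mimic hs hc hbc.le (hS hσ) ho ho' hm h1 h2) i
    rw [profile_succ_self, profile_succ_self] at this
    exact this
  · intro σ hσ e he
    obtain ⟨ho, ho'⟩ := hover σ hσ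
    exact outcomeSeq_mimic hs hc hbc.le (hS hσ) ho ho' (e := e) (Nat.le_of_lt_succ he)

/-- Where bidder `i` is active again only after the higher bid, she can then bid `0`. -/
theorem futureFavours_of_subset (hT : h.2.length + 1 < P.T)
    (hd : P.IsDemand i h.1 (P.p (h.2.length + 2)) d) (hc : c ∈ P.bids i h) (hbc : b < c)
    (hcd : c ≤ d) {S : Set (P.game.OppStrategy i)}
    (hS : S ⊆ ending (G := P.game) (i := i) h b)
    (hSc : ∀ σ ∈ S, σ ∉ ending (G := P.game) (i := i) h c) :
    FutureFavours (G := P.game) (i := i) h c b S := by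
  have hpos : 0 < c := by omega
  intro s hs
  have hs' := deviate_mem_ownStrategies hs hc fun _ => 0
  set s' : P.game.Strategy i := deviate s h c fun _ => 0 with hs'def
  refine ⟨s', hs', fun σ hσ => ?_⟩
  have hopp := (hS hσ).1
  have hNT : h.2.length < P.T := by omega
  have hK : others s' σ (h.2.length + 1) = others s σ (h.2.length + 1) :=
    others_of_mem hs' hs hopp
  have hendb : b = 0 ∨ b + others s σ (h.2.length + 1) ≤ P.M :=
    (mem_ending_iff hc hpos hT hs hopp).mp (hS hσ)
  have hendc : ¬ c + others s' σ (h.2.length + 1) ≤ P.M := fun hle =>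
    hSc σ hσ ((mem_ending_iff hc hpos hT hs' hopp).mpr (Or.inr hle))
  have hval := val_of_mem hopp
  have ho := not_isOver_of_mem hc hpos hs hopp
  have ho' := not_isOver_of_mem hc hpos hs' hopp
  have hx := profile_self_of_mem hs hopp
  have hx' := profile_self_of_mem hs' hopp
  have hpath := path_of_mem hs hs' hopp
  change utility i (nature σ) (outcomeSeqUpTo (h.2.length + 1) s' σ) ≤
      utility i (nature σ) (outcomeSeq s' σ) ∧
    utility i (nature σ) (outcomeSeq s σ) ≤
      utility i (nature σ) (outcomeSeqUpTo (h.2.length + 1) s' σ) ∧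
    utility i (nature σ) (outcomeSeq s σ) ≤
      utility i (nature σ) (outcomeSeqUpTo (h.2.length + 1) s σ)
  refine ⟨?_, ?_⟩
  · refine utility_upTo_le_of_bid_zero hT (hval ▸ hd) (hx'.trans_le hcd) ?_ ?_
    · rw [profile_succ_self, hs'def]
      refine bidOf_deviate_after s c ?_ (zero_mem_bids i _)
      rw [length_observed]
      exact Nat.lt_succ_self _
    · rwa [← Bool.not_eq_true, isOver_path_iff_of_mem hc hpos hs' hopp]
  by_cases hle : b + others s σ (h.2.length + 1) ≤ P.M
  · rw [outcomeSeq_eq_upTo_of_isOver ((isOver_path_iff_of_mem hc hpos hs hopp).mpr hle)]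
    refine ⟨?_, le_rfl⟩
    have hq := quantity_upTo hNT ho
    have hq' := quantity_upTo hNT ho'
    have hprev : profile s' σ h.2.length = profile s σ h.2.length := by
      rw [profile, profile, hpath]
    rw [rationed_congr (b := profile s σ h.2.length) (x := profile s σ (h.2.length + 1)) _
      (fun _ _ => congrFun hprev _) (fun _ hj => profile_ne_of_mem hs' hs hopp hj), hprev] at hq'
    rw [utility_upTo hNT ho rfl, utility_upTo hNT ho' rfl]
    apply add_le_add
    · rw [hval]
      -- Both quantities share the rationed term; if the larger floor binds, it is at most `c ≤ d`.
      rcases (show quantity i (outcomeSeqUpTo (h.2.length + 1) s σ) =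
          quantity i (outcomeSeqUpTo (h.2.length + 1) s' σ) ∨
        quantity i (outcomeSeqUpTo (h.2.length + 1) s σ) ≤
          quantity i (outcomeSeqUpTo (h.2.length + 1) s' σ) ∧
        quantity i (outcomeSeqUpTo (h.2.length + 1) s' σ) ≤ d by omega) with e | ⟨h1, h2⟩
      · rw [e]
      · exact surplus_mono hd (P.price_increasing.monotone (Nat.le_succ _)) h1 h2
    · refine (Finset.sum_congr rfl fun t ht => ?_).le
      rw [lowerAt_eq_of_path_eq (Finset.mem_Icc.mp ht).2 hpath]
  · have hlt : P.M < others s σ (h.2.length + 1) := by omega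
    have hb0 : b = 0 := hendb.resolve_right hle
    rw [utility_outcomeSeq_eq_zero hT hlt (hx.trans hb0), utility_upTo_eq_zero hNT hlt,
      utility_upTo_eq_zero hNT (hlt.trans_eq hK.symm)]
    exact ⟨le_rfl, le_rfl⟩

theorem slotPref_upper (hd : P.IsDemand i h.1 (P.p (h.2.length + 2)) d) (hc : c ∈ P.bids i h)
    (hbc : b < c) (hcd : c ≤ d) {t : Fin P.T} (ht : t.1 = h.2.length)
    {σ' σ : P.game.OppStrategy i} {s' s : P.game.Strategy i}
    (hσ' : σ' ∈ oppStrategies (G := P.game) (i := i) h)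
    (hσ : σ ∈ oppStrategies (G := P.game) (i := i) h)
    (hs' : s' ∈ ownStrategies (G := P.game) (i := i) h c)
    (hs : s ∈ ownStrategies (G := P.game) (i := i) h b) :
    slotPref (G := P.game) i (t, .upper) σ'.1 (outcomes s' σ' (t, .upper)) σ.1
      (outcomes s σ (t, .upper)) := by
  have hpos : 0 < c := by omega
  intro y' y hy' hy hother
  have h1 := outcomeSeq_upper s' σ' (t := t) (by rw [ht]; exact not_isOver_of_mem hc hpos hs' hσ')
  have h2 := outcomeSeq_upper s σ (t := t) (by rw [ht]; exact not_isOver_of_mem hc hpos hs hσ)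
  rw [ht, profile_self_of_mem hs' hσ'] at h1
  rw [ht, profile_self_of_mem hs hσ] at h2
  exact utility_mono_upper (val_of_mem hσ) (val_of_mem hσ') (by rwa [ht]) hbc.le hcd
    (hy'.trans h1) (hy.trans h2) hother

theorem slotPref_lower (hT : h.2.length + 1 < P.T)
    (hd : P.IsDemand i h.1 (P.p (h.2.length + 2)) d) (hc : c ∈ P.bids i h)
    (hbc : b < c) (hcd : c ≤ d) {t : Fin P.T} (ht : t.1 = h.2.length)
    {σ' σ : P.game.OppStrategy i} {s' s : P.game.Strategy i}
    (hσ' : σ' ∈ ending (G := P.game) (i := i) h b)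
    (hσ : σ ∈ ending (G := P.game) (i := i) h b)
    (hs' : s' ∈ ownStrategies (G := P.game) (i := i) h c)
    (hs : s ∈ ownStrategies (G := P.game) (i := i) h b) :
    slotPref (G := P.game) i (t, .lower) σ'.1 (outcomes s' σ' (t, .lower)) σ.1
      (outcomes s σ (t, .lower)) := by
  have hpos : 0 < c := by omega
  intro y' y hy' hy hother
  have h1 := outcomeSeq_lower s' σ' (t := t) (by rw [ht]; exact not_isOver_of_mem hc hpos hs' hσ'.1)
  have h2 := outcomeSeq_lower s σ (t := t) (by rw [ht]; exact not_isOver_of_mem hc hpos hs hσ.1)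
  rw [ht, profile_self_of_mem hs' hσ'.1, clinched_profile] at h1
  rw [ht, profile_self_of_mem hs hσ.1, clinched_profile] at h2
  -- The outcomes compared may come from different opponents. Inactivity after `b` against `σ'`
  -- makes the one after `c` at least `b`, while the one after `b` never exceeds `b`.
  have h3 : b = 0 ∨ b + others s σ' (h.2.length + 1) ≤ P.M :=
    (mem_ending_iff hc hpos hT hs hσ'.1).mp hσ'
  have h4 : others s' σ' (h.2.length + 1) = others s σ' (h.2.length + 1) :=
    others_of_mem hs' hs hσ'.1
  exact utility_mono_lower (val_of_mem hσ.1) (val_of_mem hσ'.1) (by rwa [ht]) (by omega)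
    (by omega) (hy'.trans h1) (hy.trans h2) hother

/-- Both bids exceed the truncated residual supply, which is therefore the minimum in either case.
-/
theorem outcomes_lower_eq (hT : h.2.length + 1 < P.T) (hc : c ∈ P.bids i h) (hbc : b < c)
    {t : Fin P.T} (ht : t.1 = h.2.length) {σ : P.game.OppStrategy i} {s' s : P.game.Strategy i}
    (hσ : σ ∈ oppStrategies (G := P.game) (i := i) h)
    (hσb : σ ∉ ending (G := P.game) (i := i) h b)
    (hs' : s' ∈ ownStrategies (G := P.game) (i := i) h c)
    (hs : s ∈ ownStrategies (G := P.game) (i := i) h b) :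
    outcomeSeq s' σ (t, .lower) = outcomeSeq s σ (t, .lower) := by
  have hpos : 0 < c := by omega
  rw [outcomeSeq_lower s' σ (by rw [ht]; exact not_isOver_of_mem hc hpos hs' hσ),
    outcomeSeq_lower s σ (by rw [ht]; exact not_isOver_of_mem hc hpos hs hσ), ht,
    profile_self_of_mem hs' hσ, profile_self_of_mem hs hσ, clinched_profile, clinched_profile]
  have h3 : ¬ (b = 0 ∨ b + others s σ (h.2.length + 1) ≤ P.M) :=
    mt (mem_ending_iff hc hpos hT hs hσ).mpr hσb
  have h4 : others s' σ (h.2.length + 1) = others s σ (h.2.length + 1) :=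
    others_of_mem hs' hs hσ
  congr 1
  omega

theorem outcomes_excess_eq (hc : c ∈ P.bids i h) (hpos : 0 < c) {a a' : ℕ}
    {t : Fin P.T} (ht : t.1 = h.2.length) {σ : P.game.OppStrategy i} {s' s : P.game.Strategy i}
    (hσ : σ ∈ oppStrategies (G := P.game) (i := i) h)
    (hs' : s' ∈ ownStrategies (G := P.game) (i := i) h a')
    (hs : s ∈ ownStrategies (G := P.game) (i := i) h a) :
    outcomeSeq s' σ (t, .excess) = outcomeSeq s σ (t, .excess) := by
  have hprev : profile s' σ h.2.length = profile s σ h.2.length := by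
    rw [profile, profile, path_of_mem hs' hs hσ]
  rw [outcomeSeq_excess s' σ (by rw [ht]; exact not_isOver_of_mem hc hpos hs' hσ),
    outcomeSeq_excess s σ (by rw [ht]; exact not_isOver_of_mem hc hpos hs hσ), ht, hprev,
    rationed_congr _ (fun _ _ => rfl) fun _ hj => profile_ne_of_mem hs' hs hσ hj]

/-- A bid between `b` and the demand at the next price locally stage-dominates `b`. -/
theorem locallyStageDominates_of_lt (hT : h.2.length + 1 < P.T)
    (hd : P.IsDemand i h.1 (P.p (h.2.length + 2)) d) (hc : c ∈ P.bids i h) (hbc : b < c)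
    (hcd : c ≤ d) : LocallyStageDominates (G := P.game) (i := i) h c b := by
  intro S hS
  have hpos : 0 < c := by omega
  have hopp : S ⊆ oppStrategies (G := P.game) (i := i) h := by
    rcases hS with rfl | rfl | rfl | rfl
    exacts [fun σ hσ => hσ.1.1, fun σ hσ => hσ.1.1, fun σ hσ => hσ.1.1, fun σ hσ => hσ.1]
  -- Activity after `b` alone decides whether the lower outcomes are ranked or equal.
  have hcase : S ⊆ ending (G := P.game) (i := i) h b ∨
      ∀ σ ∈ S, σ ∉ ending (G := P.game) (i := i) h b := by
    rcases hS with rfl | rfl | rfl | rfl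
    exacts [Or.inl fun σ hσ => hσ.1, Or.inl fun σ hσ => hσ.1, Or.inr fun σ hσ => hσ.2,
      Or.inr fun σ hσ hb => hσ.2 (Or.inr hb)]
  refine ⟨?_, ?_⟩
  · rcases hS with rfl | rfl | rfl | rfl
    · exact Or.inl (locallyRelevant_of_subset_ending hT hc hbc fun σ hσ => hσ.2)
    · exact Or.inr (futureFavours_of_subset hT hd hc hbc hcd (fun σ hσ => hσ.1) fun σ hσ => hσ.2)
    -- This scenario is in fact empty, since `c > 0` ending the auction means that `b` ends it too;
    -- the argument for activity after `b` covers it anyway.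
    · exact Or.inl (locallyRelevant_of_disjoint_ending hT hc hbc hopp fun σ hσ => hσ.2)
    · exact Or.inl (locallyRelevant_of_disjoint_ending hT hc hbc hopp fun σ hσ hb =>
        hσ.2 (Or.inr hb))
  · rintro ⟨t, k⟩ he
    have ht : t.1 = h.2.length := Nat.succ.inj he
    cases k with
    | upper =>
      exact Or.inl fun σ' hσ' σ hσ s' hs' s hs =>
        slotPref_upper hd hc hbc hcd ht (hopp hσ') (hopp hσ) hs' hs
    | lower =>
      rcases hcase with hin | hout
      · exact Or.inl fun σ' hσ' σ hσ s' hs' s hs =>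
          slotPref_lower hT hd hc hbc hcd ht (hin hσ') (hin hσ) hs' hs
      · exact Or.inr fun σ hσ s' hs' s hs =>
          outcomes_lower_eq hT hc hbc ht (hopp hσ) (hout σ hσ) hs' hs
    | excess =>
      exact Or.inr fun σ hσ s' hs' s hs => outcomes_excess_eq hc hpos ht (hopp hσ) hs' hs

end AusubelAuction

theorem proposition5 {n : ℕ} (P : AusubelAuction n) (i : Fin n)
    (h : BidderValuation × List (ℕ × Bool)) (hh : h ∈ P.game.activeInfoSets i)
    (hT : P.game.infoStage i h < P.T)
    (d : ℕ) (hd : P.IsDemand i h.1 (P.p (P.game.infoStage i h + 1)) d)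
    (b : ℕ) (hb : b ∈ P.bids i h) (hbd : b < d)
    (hlarger : ∃ c ∈ P.bids i h, b < c) :
    MultistageGame.LocallyStageDominated (G := P.game) (i := i) h b ∧
    ∀ c ∈ P.bids i h, b < c → c ≤ d →
      MultistageGame.LocallyStageDominates (G := P.game) (i := i) h c b := by
  have key : ∀ c ∈ P.bids i h, b < c → c ≤ d →
      MultistageGame.LocallyStageDominates (G := P.game) (i := i) h c b :=
    fun c hc hbc hcd => AusubelAuction.locallyStageDominates_of_lt hT hd hc hbc hcd
  obtain ⟨c, hc, hbc⟩ := hlarger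
  -- The larger available bid `c` may exceed `d`; `b + 1` does not, and it is available because
  -- available bids are closed downwards.
  have hc' : b + 1 ∈ P.bids i h := AusubelAuction.mem_bids_of_le hc hbc
  exact ⟨⟨b + 1, hc', Nat.succ_ne_self b, key _ hc' (Nat.lt_succ_self b) hbd⟩, key⟩
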